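/- Let $\Bbbk$ be a field and let $1\le r_1\le\cdots\le r_n$ be integers with either $n=3$ and $r_1\ge 2$, or $n\ge 4$. Let $G=K_{r_1,\ldots,r_n}$ be the complete multipartite graph on $V=V_1\sqcup\cdots\sqcup V_n$, $|V_i|=r_i$, $V_i=\{v_{i1},\ldots,v_{ir_i}\}$, and let $R=\Bbbk[G]\subset\Bbbk[t_v : v\in V]$ be its edge ring, i.e. the $\Bbbk$-subalgebra generated by the monomials $t_at_b$ for the edges $\{a,b\}$ of $G$. Let $L\subset\mathbb Z^V$ and $C\subset\mathbb R^V$ be the lattice and the convex cone generated by the vectors $\mathbf e_a+\mathbf e_b$, $\{a,b\}$ an edge of $G$. For each facet $F$ of $C$ let $\tau_F$ be the linear form on $\mathbb R^V$ that is nonnegative on $C$, vanishes on $F$ and satisfies $\tau_F(L)=\mathbb Z$. These are the $d+n$ forms ($d=|V|$) $x_v$ ($v\in V$) and $\sigma_i=\frac12\big(\sum_{v\notin V_i}x_v-\sum_{v\in V_i}x_v\big)$ ($1\le i\le n$). For integers $\mathbf a=(a_F)_F$ let $T(\mathbf a)$ be the $R$-module generated by the Laurent monomials $t^\alpha$ with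 $\alpha\in L$ and $\tau_F(\alpha)\ge a_F$ for all $F$. A conic divisorial ideal of $R$ is a module $T(\mathbf a)$ such that, for some $x\in\mathbb R^V$, $a_F=\lceil\tau_F(x)\rceil$ for all $F$; conic divisorial ideals are considered up to isomorphism of $R$-modules. For $z\in\mathbb Z^n$ let $T_z$ be the module $T(\mathbf a)$ where $\mathbf a$ has the entry $z_i$ at $\sigma_i$ for $1\le i\le n-1$, the entry $z_n$ at the coordinate form $x_{v_{n,r_n}}$, and the entry $0$ at the other $d$ forms. Let $\mathcal C(r_1,\ldots,r_n)$ be the set of all $(z_1,\ldots,z_n)\in\mathbb R^n$ such that 1. $-r_i\le z_j-z_i\le r_j$ for all $1\le i,j\le n$; 2. $-|J|-\sum_{i\in[n-1]\setminus I}r_i-\sum_{j\in J}r_j+1\le\sum_{i\in I}z_i-\sum_{j\in J}z_j\le|J|+1$ for every set $I\subset[n-1]$ and every multiset $J$ of elements of $[n-1]$ with $|I|=|J|+1$ and $I\cap J=\emptyset$; 3. $-|J|-\sum_{i\in[n-1]\setminus I}r_i-\sum_{j\in J}r_j+2\le\sum_{i\in I}z_i-\sum_{j\in J}z_j\le|J|$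 for every set $I\subset[n-1]$ and every multiset $J$ of elements of $[n]$ with $|I|=|J|+1$, $n\in J$ and $I\cap J=\emptyset$. Here $|J|$ and the sums over $J$ count multiplicities, and $J=\emptyset$ is allowed in 2. Then every conic divisorial ideal of $R$ is isomorphic to $T_z$ for some $z\in\mathcal C(r_1,\ldots,r_n)\cap\mathbb Z^n$, and $T_z\not\cong T_{z'}$ for different points $z,z'$ of $\mathcal C(r_1,\ldots,r_n)\cap\mathbb Z^n$. If moreover $n\le 4$, then $T_z$ is a conic divisorial ideal for every $z\in\mathcal C(r_1,\ldots,r_n)\cap\mathbb Z^n$; hence $z\mapsto T_z$ induces a one-to-one correspondence between $\mathcal C(r_1,\ldots,r_n)\cap\mathbb Z^n$ and the isomorphism classes of conic divisorial ideals of $R$. -/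

import Mathlib

open scoped NNReal

noncomputable section

namespace ConicEdge

/-- Two `R`-submodules of an `R`-module are isomorphic as `R`-modules. -/
def Isomorphic {R K : Type*} [CommRing R] [AddCommGroup K] [Module R K]
    (M N : Submodule R K) : Prop :=
  Nonempty (M ≃ₗ[R] N)

/-! ### Edge rings, their lattices and cones -/

section Graph

variable (k : Type*) [Field k] {V : Type*} [Fintype V] [DecidableEq V] (G : SimpleGraph V)

/-- The edge ring `k[G]`: the subalgebra of the polynomial ring in the vertices of `G` that is
generated by the monomials `t_a t_b` of the edges `{a, b}`. -/
def edgeRing : Subalgebra k (MvPolynomial V k) :=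
  Algebra.adjoin k
    {p | ∃ a b : V, G.Adj a b ∧ p = MvPolynomial.X a * MvPolynomial.X b}

/-- The vectors `ρ(e) = e_a + e_b` of the edges `e = {a, b}`, with entries in `A`
(used for `A = ℤ` and `A = ℝ`). -/
def edgeVectors (A : Type*) [Semiring A] : Set (V → A) :=
  {x | ∃ a b : V, G.Adj a b ∧ x = Pi.single a 1 + Pi.single b 1}

/-- The lattice of `k[G]`: the group of exponent vectors generated by the `ρ(e)`. -/
def edgeLattice : AddSubgroup (V → ℤ) :=
  AddSubgroup.closure (edgeVectors G ℤ)

/-- The cone of `k[G]`: the cone over the edge polytope, generated by the `ρ(e)`. -/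
def edgeCone : PointedCone ℝ (V → ℝ) :=
  PointedCone.hull ℝ (edgeVectors G ℝ)

/-- An integer vector, seen as a real vector. -/
def toReal (α : V → ℤ) : V → ℝ := fun v => (α v : ℝ)

/-- `ℓ` is the normalized linear form of a facet of the cone of `k[G]`: it is nonnegative on the
cone, the face of the cone on which it vanishes has codimension one in the cone, and the set of
its values on the lattice is exactly `ℤ`. If `G` is connected and not bipartite, then the cone is
full-dimensional and every facet has exactly one such form. -/
def IsSupportForm (ℓ : Module.Dual ℝ (V → ℝ)) : Prop :=
  (∀ x ∈ edgeCone G, 0 ≤ ℓ x) ∧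
  Module.finrank ℝ (Submodule.span ℝ {x | x ∈ edgeCone G ∧ ℓ x = 0}) + 1 =
    Module.finrank ℝ (Submodule.span ℝ (edgeCone G : Set (V → ℝ))) ∧
  ∀ c : ℝ, (∃ α ∈ edgeLattice G, ℓ (toReal α) = c) ↔ ∃ m : ℤ, c = (m : ℝ)

/-- The Laurent monomial `t^α`, as an element of the field of rational functions in the
vertices of `G`. -/
def laurentMonomial (α : V → ℤ) : FractionRing (MvPolynomial V k) :=
  ∏ v : V, algebraMap (MvPolynomial V k) (FractionRing (MvPolynomial V k))
    (MvPolynomial.X v) ^ α v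

/-- The `k[G]`-module `T(a)`, for a family `τ` of linear forms and integers `a_j`: it is generated
by the Laurent monomials `t^α` with `α` in the lattice of `k[G]` and `τ_j(α) ≥ a_j` for all `j`. -/
def divisorialIdeal {ι : Type*} (τ : ι → Module.Dual ℝ (V → ℝ)) (a : ι → ℤ) :
    Submodule (edgeRing k G) (FractionRing (MvPolynomial V k)) :=
  Submodule.span (edgeRing k G)
    {f | ∃ α ∈ edgeLattice G, (∀ j, (a j : ℝ) ≤ τ j (toReal α)) ∧ f = laurentMonomial k α}

/-- `M` is a conic divisorial ideal of `k[G]`: with `τ` the family of the normalized linear forms of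
the facets of the cone, `M = T(a)` for `a = ⌈τ(x)⌉` with a real vector `x`. -/
def IsConicDivisorialIdeal
    (M : Submodule (edgeRing k G) (FractionRing (MvPolynomial V k))) : Prop :=
  ∃ x : V → ℝ, M = divisorialIdeal k G
    (fun ℓ : {ℓ : Module.Dual ℝ (V → ℝ) // IsSupportForm G ℓ} => ℓ.1) (fun ℓ => ⌈ℓ.1 x⌉)

end Graph

/-! ### Complete multipartite graphs

The index `i : Fin n` stands for the part number `i + 1`, so that the last part is the one with
`i + 1 = n`. The vertices of the part `i` are the pairs `⟨i, s⟩` with `s : Fin (r i)`. -/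

section Multipartite

variable {n : ℕ} (r : Fin n → ℕ)

/-- The vertex set of `K_{r_1, …, r_n}`. -/
abbrev Vert : Type := Σ i : Fin n, Fin (r i)

/-- The complete multipartite graph `K_{r_1, …, r_n}`. -/
abbrev multipartite : SimpleGraph (Vert r) :=
  SimpleGraph.completeMultipartiteGraph (fun i : Fin n => Fin (r i))

/-- The `d + n` linear forms of `K_{r_1, …, r_n}`: the coordinates `x_v`, and, for each
part `V_i`, the form `½ (∑_{v ∉ V_i} x_v - ∑_{v ∈ V_i} x_v)`. -/
def forms : Vert r ⊕ Fin n → Module.Dual ℝ (Vert r → ℝ)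
  | Sum.inl v => LinearMap.proj v
  | Sum.inr i => (1 / 2 : ℝ) •
      ∑ v : Vert r, (if v.1 = i then (-1 : ℝ) else 1) • LinearMap.proj v

/-- The integers `a` attached to `z ∈ ℤⁿ`: `z_i` for the form of the part `V_i` if `i < n`, `z_n`
for the coordinate of the last vertex of the last part, and `0` for the other `d` forms. -/
def exponents (z : Fin n → ℤ) : Vert r ⊕ Fin n → ℤ
  | Sum.inl v => if (v.1 : ℕ) + 1 = n ∧ (v.2 : ℕ) + 1 = r v.1 then z v.1 else 0
  | Sum.inr i => if (i : ℕ) + 1 = n then 0 else z i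

/-- The divisorial ideal `T(0, …, 0, z_1, …, z_n)` of `k[K_{r_1, …, r_n}]`. -/
def idealOf (k : Type*) [Field k] (z : Fin n → ℤ) :
    Submodule (edgeRing k (multipartite r)) (FractionRing (MvPolynomial (Vert r) k)) :=
  divisorialIdeal k (multipartite r) (forms r) (exponents r z)

/-- The polytope `𝒞(r_1, …, r_n)`. Here `J` is a multiset, and `|J|` and the sums over `J` count
multiplicities. -/
def conicRegion : Set (Fin n → ℝ) :=
  {z | (∀ i j : Fin n, -(r i : ℝ) ≤ z j - z i ∧ z j - z i ≤ r j) ∧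
    (∀ (I : Finset (Fin n)) (J : Multiset (Fin n)),
      (∀ i ∈ I, (i : ℕ) + 1 < n) → (∀ j ∈ J, (j : ℕ) + 1 < n) →
      I.card = J.card + 1 → (∀ i ∈ I, i ∉ J) →
        -(J.card : ℝ)
            - ∑ i ∈ Finset.univ.filter (fun i : Fin n => (i : ℕ) + 1 < n ∧ i ∉ I), (r i : ℝ)
            - (J.map fun j => (r j : ℝ)).sum + 1
          ≤ ∑ i ∈ I, z i - (J.map z).sum ∧
        ∑ i ∈ I, z i - (J.map z).sum ≤ (J.card : ℝ) + 1) ∧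
    (∀ (I : Finset (Fin n)) (J : Multiset (Fin n)),
      (∀ i ∈ I, (i : ℕ) + 1 < n) → (∃ j ∈ J, (j : ℕ) + 1 = n) →
      I.card = J.card + 1 → (∀ i ∈ I, i ∉ J) →
        -(J.card : ℝ)
            - ∑ i ∈ Finset.univ.filter (fun i : Fin n => (i : ℕ) + 1 < n ∧ i ∉ I), (r i : ℝ)
            - (J.map fun j => (r j : ℝ)).sum + 2
          ≤ ∑ i ∈ I, z i - (J.map z).sum ∧
        ∑ i ∈ I, z i - (J.map z).sum ≤ (J.card : ℝ))}

/-- The lattice points `𝒞(r_1, …, r_n) ∩ ℤⁿ`. -/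
def conicPoints : Set (Fin n → ℤ) :=
  {z | (fun i => (z i : ℝ)) ∈ conicRegion r}

end Multipartite

end ConicEdge

end

/-!
Write `σ_i` for the form of the part `i`, `N` for the last part and `w` for the last vertex.

*Facets.* A form that is nonnegative on all edge vectors is a nonnegative combination of the
coordinates and one of the `σ_i`: negative coefficients can occur in a single part only
(`exists_forms_mul_le`). Hence the normalized forms of the facets are the `d + n` forms of the
statement (`isSupportForm_iff`).

*Isomorphisms.* An isomorphism `T(a) ≅ T(b)` is multiplication by a rational function `h`, and
both `h` and its inverse are Laurent polynomials, so that `h` is a scalar times a monomial `t^γ`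
(`Isomorphic.exists_shift`). As every inequality `τ_F(α) ≥ a_F` is attained, `T(a) ≅ T(b)` holds
if and only if `b - a` consists of the values at a lattice vector `γ`. It follows that different
`z ∈ ℤⁿ` give non-isomorphic modules `T_z` (`eq_of_isomorphic_idealOf`), and that each conic ideal
is isomorphic to some `T_z` for which `⌈τ_F(y)⌉` is the exponent vector of `z` with a suitable
translate `y` of `x` (`exists_ceil_sub_eq_exponents`).

*The region.* Let `F_i` be the sum of the rounding errors of `y` over the part `i`. Then
`0 ≤ F_i < r_i`, and `z_i = ⌈u + F_i⌉` for all `i`, where `2u = z_N - ∑ F_j`. Conversely each such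
`F` comes from a vector `y`. So the conic ideals correspond to the vectors `z` with
`IsRounding r N z F` for some `F`. Adding up `u + F_i ≤ z_i < u + F_i + 1` over `I` and `J`, and
using that `z` is integral, gives the inequalities of the region
(`IsRounding.sum_bounds_of_notMem`, `IsRounding.sum_bounds_of_mem`).

For the converse let `s` be an integer with `0 ≤ z_i - s ≤ r_i` for all `i` and look for
`u = s - θ` with `0 ≤ θ < 1`. Put `D = z_N - 2s - ∑ (z_i - s)`, and let `P` and `Q` be the numbers
of indices with `z_i - s > 0` and with `z_i - s < r_i`. A vector `F` exists if
`-P + (P - 2) θ < D < (Q - 2) θ`, and some `θ` satisfies this if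
`min (1 - P) (-1) ≤ D ≤ max (Q - 3) (-1)`. At the largest shift the lower bound for `D` is an
inequality of the region, at the smallest shift so is the upper bound, and in between the
admissible intervals overlap (`exists_isRounding`). This argument works for every `n ≥ 3`.
-/

namespace ConicEdge

/-! ### The region as the set of simultaneous roundings -/

section Rounding

variable {ι : Type*}

/-- `z` is the vector of the integers `⌈u + F i⌉`, where `0 ≤ F i < r i` and
`u = (z N - ∑ j, F j) / 2` is determined by `F` and the entry of `z` at the distinguished index
`N`. Here `F i` stands for the total rounding error `∑ (⌈x_v⌉ - x_v)` over the vertices `v` of the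
part `i`. The ceilings are spelled out as pairs of inequalities. -/
def IsRounding [Fintype ι] (r : ι → ℕ) (N : ι) (z : ι → ℤ) (F : ι → ℝ) : Prop :=
  ∀ i, 0 ≤ F i ∧ F i < r i ∧ (z i : ℝ) - 1 < (z N - ∑ j, F j) / 2 + F i ∧
    (z N - ∑ j, F j) / 2 + F i ≤ z i

theorem sum_eq_add_sum_add_sum [Fintype ι] [DecidableEq ι] (N : ι) (I : Finset ι) (hI : N ∉ I)
    {M : Type*} [AddCommMonoid M] (f : ι → M) :
    ∑ i, f i = f N + ∑ i ∈ I, f i + ∑ i with i ≠ N ∧ i ∉ I, f i := by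
  rw [← Finset.sum_filter_add_sum_filter_not Finset.univ (fun i => i ∈ I) f,
    ← Finset.add_sum_erase (Finset.univ.filter fun i => i ∉ I) f (a := N) (by simpa using hI)]
  have h1 : Finset.univ.filter (fun i => i ∈ I) = I := by ext; simp
  have h2 : (Finset.univ.filter fun i => i ∉ I).erase N =
      Finset.univ.filter (fun i => i ≠ N ∧ i ∉ I) := by ext; simp
  rw [h1, h2]; abel

theorem multiset_sum_const_add (J : Multiset ι) (t : ℝ) (F : ι → ℝ) :
    (J.map fun j => t + F j).sum = J.card * t + (J.map F).sum := by
  rw [Multiset.sum_map_add]; simp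

theorem IsRounding.sub_bounds [Fintype ι] {r : ι → ℕ}
    {N : ι} {z : ι → ℤ} {F : ι → ℝ} (h : IsRounding r N z F) (i j : ι) :
    -(r i : ℤ) ≤ z j - z i ∧ z j - z i ≤ r j := by
  obtain ⟨a1, a2, a3, a4⟩ := h i
  obtain ⟨b1, b2, b3, b4⟩ := h j
  constructor
  · have : (-(r i : ℝ)) < z j - z i + 1 := by linarith
    have : (-(r i : ℤ)) < z j - z i + 1 := by exact_mod_cast this
    omega
  · have : (z j : ℝ) - z i < r j + 1 := by linarith
    have : z j - z i < r j + 1 := by exact_mod_cast this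
    omega

/-- The number `u` occurs once more in the sum over `I` than in the sum over `J`. As
`z N = 2 * u + ∑ j, F j`, the inequalities `u + F N ≤ z N < u + F N + 1` bound it from both sides
in terms of the sum of `F` over the indices other than `N`. -/
theorem IsRounding.sum_bounds_of_notMem [Fintype ι] [DecidableEq ι] {r : ι → ℕ}
    {N : ι} {z : ι → ℤ} {F : ι → ℝ} (h : IsRounding r N z F)
    (hcard : 3 ≤ Fintype.card ι) (I : Finset ι) (J : Multiset ι)
    (hI : N ∉ I) (hIJ : I.card = J.card + 1) :
    -(J.card : ℤ) - ∑ i with i ≠ N ∧ i ∉ I, (r i : ℤ) - (J.map fun j => (r j : ℤ)).sum + 1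
        ≤ ∑ i ∈ I, z i - (J.map z).sum ∧
      ∑ i ∈ I, z i - (J.map z).sum ≤ J.card + 1 := by
  set t : ℝ := (z N - ∑ j, F j) / 2 with ht
  have hzJ : (((J.map z).sum : ℤ) : ℝ) = (J.map fun j => (z j : ℝ)).sum := by
    simp [Int.cast_multiset_sum, Multiset.map_map]
  have hrJ : (((J.map fun j => (r j : ℤ)).sum : ℤ) : ℝ) = (J.map fun j => (r j : ℝ)).sum := by
    simp [Int.cast_multiset_sum, Multiset.map_map]
  have hne : I.Nonempty := by rw [← Finset.card_pos]; omega
  have hc : (I.card : ℝ) = J.card + 1 := by exact_mod_cast hIJ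
  have hsum := sum_eq_add_sum_add_sum N I hI F
  have hN := h N
  have hJ0 : 0 ≤ (J.map F).sum := Multiset.sum_nonneg fun x hx => by
    obtain ⟨j, -, rfl⟩ := Multiset.mem_map.1 hx
    exact (h j).1
  have hR0 : 0 ≤ ∑ i with i ≠ N ∧ i ∉ I, F i := Finset.sum_nonneg fun i _ => (h i).1
  have hIlt : ∑ i ∈ I, (z i : ℝ) < ∑ i ∈ I, (t + 1 + F i) :=
    Finset.sum_lt_sum_of_nonempty hne fun i _ => by linarith [(h i).2.2.1]
  have hIge : ∑ i ∈ I, (t + F i) ≤ ∑ i ∈ I, (z i : ℝ) :=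
    Finset.sum_le_sum fun i _ => (h i).2.2.2
  have hJge : (J.map fun j => t + F j).sum ≤ (J.map fun j => (z j : ℝ)).sum :=
    Multiset.sum_map_le_sum_map _ _ fun j _ => (h j).2.2.2
  have hJle : (J.map fun j => (z j : ℝ)).sum ≤ (J.map fun j => (t + 1) + F j).sum :=
    Multiset.sum_map_le_sum_map _ _ fun j _ => by linarith [(h j).2.2.1]
  have hJr : (J.map F).sum ≤ (J.map fun j => (r j : ℝ)).sum :=
    Multiset.sum_map_le_sum_map _ _ fun j _ => (h j).2.1.le
  have hRr : ∑ i with i ≠ N ∧ i ∉ I, F i ≤ ∑ i with i ≠ N ∧ i ∉ I, (r i : ℝ) :=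
    Finset.sum_le_sum fun i _ => (h i).2.1.le
  rw [multiset_sum_const_add] at hJge hJle
  rw [Finset.sum_add_distrib, Finset.sum_const, nsmul_eq_mul, hc] at hIlt hIge
  constructor
  · -- either `J` or the complement of `I ∪ {N}` is nonempty, since there are at least three indices
    have hlt : -(J.card : ℝ) - ∑ i with i ≠ N ∧ i ∉ I, (r i : ℝ)
        - (J.map fun j => (r j : ℝ)).sum < ∑ i ∈ I, (z i : ℝ) - (J.map fun j => (z j : ℝ)).sum := by
      by_cases hR : (Finset.univ.filter fun i => i ≠ N ∧ i ∉ I).Nonempty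
      · have : ∑ i with i ≠ N ∧ i ∉ I, F i < ∑ i with i ≠ N ∧ i ∉ I, (r i : ℝ) :=
          Finset.sum_lt_sum_of_nonempty hR fun i _ => (h i).2.1
        nlinarith
      · have hJ : J ≠ 0 := by
          rintro rfl
          apply hR
          by_contra hemp
          have : Finset.univ ⊆ insert N I := fun i _ => by
            by_contra hi
            exact hemp ⟨i, by simpa [not_or] using hi⟩
          have := (Finset.card_le_card this).trans (Finset.card_insert_le _ _)
          simp at hIJ
          rw [Finset.card_univ] at this
          omega
        have : (J.map F).sum < (J.map fun j => (r j : ℝ)).sum :=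
          Multiset.sum_lt_sum_of_nonempty hJ fun j _ => (h j).2.1
        nlinarith
    have : -(J.card : ℤ) - ∑ i with i ≠ N ∧ i ∉ I, (r i : ℤ) - (J.map fun j => (r j : ℤ)).sum
        < ∑ i ∈ I, z i - (J.map z).sum := by
      rw [← hzJ, ← hrJ] at hlt
      exact_mod_cast hlt
    omega
  · have hlt : ∑ i ∈ I, (z i : ℝ) - (J.map fun j => (z j : ℝ)).sum < J.card + 2 := by nlinarith
    have : ∑ i ∈ I, z i - (J.map z).sum < J.card + 2 := by
      rw [← hzJ] at hlt
      exact_mod_cast hlt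
    omega

/-- In this case `z N = 2 * u + ∑ j, F j` is substituted exactly for one of the occurrences of `N`
in `J`, which improves both bounds by one. -/
theorem IsRounding.sum_bounds_of_mem [Fintype ι] [DecidableEq ι] {r : ι → ℕ}
    {N : ι} {z : ι → ℤ} {F : ι → ℝ} (h : IsRounding r N z F) (I : Finset ι) (J : Multiset ι)
    (hI : N ∉ I) (hJ : N ∈ J) (hIJ : I.card = J.card + 1) :
    -(J.card : ℤ) - ∑ i with i ≠ N ∧ i ∉ I, (r i : ℤ) - (J.map fun j => (r j : ℤ)).sum + 2
        ≤ ∑ i ∈ I, z i - (J.map z).sum ∧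
      ∑ i ∈ I, z i - (J.map z).sum ≤ J.card := by
  obtain ⟨J, rfl⟩ := Multiset.exists_cons_of_mem hJ
  simp only [Multiset.card_cons, Multiset.map_cons, Multiset.sum_cons] at hIJ ⊢
  set t : ℝ := (z N - ∑ j, F j) / 2 with ht
  have hzJ : (((J.map z).sum : ℤ) : ℝ) = (J.map fun j => (z j : ℝ)).sum := by
    simp [Int.cast_multiset_sum, Multiset.map_map]
  have hrJ : (((J.map fun j => (r j : ℤ)).sum : ℤ) : ℝ) = (J.map fun j => (r j : ℝ)).sum := by
    simp [Int.cast_multiset_sum, Multiset.map_map]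
  have hne : I.Nonempty := by rw [← Finset.card_pos]; omega
  have hc : (I.card : ℝ) = J.card + 1 + 1 := by exact_mod_cast hIJ
  have hsum := sum_eq_add_sum_add_sum N I hI F
  have hN := h N
  have hJ0 : 0 ≤ (J.map F).sum := Multiset.sum_nonneg fun x hx => by
    obtain ⟨j, -, rfl⟩ := Multiset.mem_map.1 hx
    exact (h j).1
  have hR0 : 0 ≤ ∑ i with i ≠ N ∧ i ∉ I, F i := Finset.sum_nonneg fun i _ => (h i).1
  have hIlt : ∑ i ∈ I, (z i : ℝ) < ∑ i ∈ I, (t + 1 + F i) :=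
    Finset.sum_lt_sum_of_nonempty hne fun i _ => by linarith [(h i).2.2.1]
  have hIge : ∑ i ∈ I, (t + F i) ≤ ∑ i ∈ I, (z i : ℝ) :=
    Finset.sum_le_sum fun i _ => (h i).2.2.2
  have hJge : (J.map fun j => t + F j).sum ≤ (J.map fun j => (z j : ℝ)).sum :=
    Multiset.sum_map_le_sum_map _ _ fun j _ => (h j).2.2.2
  have hJle : (J.map fun j => (z j : ℝ)).sum ≤ (J.map fun j => (t + 1) + F j).sum :=
    Multiset.sum_map_le_sum_map _ _ fun j _ => by linarith [(h j).2.2.1]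
  have hJr : (J.map F).sum ≤ (J.map fun j => (r j : ℝ)).sum :=
    Multiset.sum_map_le_sum_map _ _ fun j _ => (h j).2.1.le
  have hRr : ∑ i with i ≠ N ∧ i ∉ I, F i ≤ ∑ i with i ≠ N ∧ i ∉ I, (r i : ℝ) :=
    Finset.sum_le_sum fun i _ => (h i).2.1.le
  rw [multiset_sum_const_add] at hJge hJle
  rw [Finset.sum_add_distrib, Finset.sum_const, nsmul_eq_mul, hc] at hIlt hIge
  have hzN : (z N : ℝ) = 2 * t + ∑ j, F j := by rw [ht]; ring
  constructor
  · have hlt : -(J.card : ℝ) - ∑ i with i ≠ N ∧ i ∉ I, (r i : ℝ)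
        - (r N + (J.map fun j => (r j : ℝ)).sum) <
          ∑ i ∈ I, (z i : ℝ) - (z N + (J.map fun j => (z j : ℝ)).sum) := by
      nlinarith
    have : -(J.card : ℤ) - ∑ i with i ≠ N ∧ i ∉ I, (r i : ℤ) -
        (r N + (J.map fun j => (r j : ℤ)).sum) < ∑ i ∈ I, z i - (z N + (J.map z).sum) := by
      rw [← hzJ, ← hrJ] at hlt
      exact_mod_cast hlt
    push_cast
    omega
  · have hlt : ∑ i ∈ I, (z i : ℝ) - (z N + (J.map fun j => (z j : ℝ)).sum) < J.card + 2 := by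
      nlinarith
    have : ∑ i ∈ I, z i - (z N + (J.map z).sum) < J.card + 2 := by
      rw [← hzJ] at hlt
      exact_mod_cast hlt
    push_cast
    omega

/-- The inequalities of the region at an extreme shift imply a bound that involves only the number
of positive entries: take for `I` the set of the positive entries other than `N`, and for the
multiset the required number of copies of one index at which `w` vanishes, preferably of `N`. The
hypotheses are stated for multisets of the form `p • {j}` only. -/
theorem le_one_or_lt_card_pos [Fintype ι] [DecidableEq ι] {N : ι} {w : ι → ℤ}
    (hw : ∀ i, 0 ≤ w i) {i₀ : ι} (hi₀ : w i₀ = 0)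
    (hN : ∃ j, j ≠ N) {E : ℤ}
    (h2 : ∀ (I : Finset ι) (p : ℕ) (j : ι), N ∉ I → (p ≠ 0 → j ≠ N ∧ j ∉ I) → I.card = p + 1 →
      E ≤ p + 1 + p * w j + ∑ i with i ≠ N ∧ i ∉ I, w i)
    (h3 : ∀ (I : Finset ι) (p : ℕ), N ∉ I → I.card = p + 2 →
      E ≤ p + 1 + (p + 1) * w N + ∑ i with i ≠ N ∧ i ∉ I, w i) :
    E ≤ 1 ∨ E < (Finset.univ.filter fun i => 0 < w i).card := by
  set A : Finset ι := Finset.univ.filter fun i => i ≠ N ∧ 0 < w i with hA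
  have hNA : N ∉ A := by simp [hA]
  have key : ∀ I : Finset ι, A ⊆ I → ∑ i with i ≠ N ∧ i ∉ I, w i = 0 := fun I hI => by
    refine Finset.sum_eq_zero fun i hi => ?_
    simp only [Finset.mem_filter, Finset.mem_univ, true_and] at hi
    by_contra hne
    exact hi.2 (hI (by simp [hA, hi.1, lt_of_le_of_ne (hw i) (Ne.symm hne)]))
  obtain ⟨j₁, hj₁⟩ := hN
  rcases Nat.lt_or_ge A.card 2 with hlt | hge
  · left
    rcases Nat.lt_or_ge A.card 1 with h0 | h1
    · have hAe : A = ∅ := Finset.card_eq_zero.1 (by omega)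
      have := h2 {j₁} 0 j₁ (by simpa using hj₁.symm) (by simp) (by simp)
      rw [key _ (by simp [hAe])] at this
      simpa using this
    · have := h2 A 0 j₁ hNA (by simp) (by omega)
      rw [key _ subset_rfl] at this
      simpa using this
  · right
    by_cases hwN : w N = 0
    · have hc : (Finset.univ.filter fun i => 0 < w i) = A := by
        ext i
        simp only [hA, Finset.mem_filter, Finset.mem_univ, true_and, iff_and_self]
        rintro h rfl
        omega
      have := h3 A (A.card - 2) hNA (by omega)
      rw [key _ subset_rfl, hwN] at this
      rw [hc]
      omega
    · have hc : (Finset.univ.filter fun i => 0 < w i) = insert N A := by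
        ext i
        simp only [hA, Finset.mem_filter, Finset.mem_univ, true_and, Finset.mem_insert]
        have := hw N
        by_cases hi : i = N
        · subst hi; simp; omega
        · simp [hi]
      have := h2 A (A.card - 1) i₀ hNA
        (fun _ => ⟨by rintro rfl; exact hwN hi₀, by simp [hA, hi₀]⟩) (by omega)
      rw [key _ subset_rfl, hi₀] at this
      rw [hc, Finset.card_insert_of_notMem hNA]
      push_cast
      omega

/-- With `u = s - θ`, the numbers `F i` range over intervals with endpoints `z i - s` or
`z i - s - 1 + θ`, and `z i - s` or `z i - s + θ`, and their sum has to be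
`D + ∑ i, (z i - s) + 2 * θ`. The bounds `hlo` and `hup` say that this number lies strictly
between the sums of the endpoints, so that a convex combination of the endpoints does it. -/
theorem exists_isRounding_of_lt_of_lt [Fintype ι] {r : ι → ℕ} (hr : ∀ i, 1 ≤ r i)
    {N : ι} {z : ι → ℤ} (s : ℤ)
    (h0 : ∀ i, s ≤ z i) (h1 : ∀ i, z i - s ≤ r i) {θ : ℝ} (hθ0 : 0 ≤ θ) (hθ1 : θ < 1) {D : ℤ}
    (hD : D = z N - 2 * s - ∑ i, (z i - s)) {P Q : ℕ}
    (hP : (Finset.univ.filter fun i => 0 < z i - s).card = P)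
    (hQ : (Finset.univ.filter fun i => 0 < (r i : ℤ) - (z i - s)).card = Q)
    (hlo : -(P : ℝ) + (P - 2) * θ < D) (hup : (D : ℝ) < (Q - 2) * θ) :
    ∃ F, IsRounding r N z F := by
  set m : ι → ℤ := fun i => z i - s with hm
  set lo : ι → ℝ := fun i => m i - (if 0 < m i then 1 - θ else 0) with hlodef
  set up : ι → ℝ := fun i => m i + (if 0 < (r i : ℤ) - m i then θ else 0) with hupdef
  have hslo : ∑ i, lo i = (∑ i, m i : ℤ) - P * (1 - θ) := by
    simp only [hlodef, Finset.sum_sub_distrib, ← Finset.sum_filter, Finset.sum_const, nsmul_eq_mul]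
    rw [hP]; push_cast; ring
  have hsup : ∑ i, up i = (∑ i, m i : ℤ) + Q * θ := by
    simp only [hupdef, Finset.sum_add_distrib, ← Finset.sum_filter, Finset.sum_const, nsmul_eq_mul]
    rw [hQ]; push_cast; ring
  set Δ : ℝ := Q * θ + P * (1 - θ) with hΔ
  have hΔ0 : 0 < Δ := by rw [hΔ]; nlinarith
  set l : ℝ := (D + 2 * θ + P * (1 - θ)) / Δ with hl
  have hl0 : 0 < l := div_pos (by nlinarith) hΔ0
  have hl1 : l < 1 := by rw [hl, div_lt_one hΔ0, hΔ]; nlinarith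
  have hlΔ : l * Δ = D + 2 * θ + P * (1 - θ) := div_mul_cancel₀ _ hΔ0.ne'
  have hsF : ∑ i, (lo i + l * (up i - lo i)) = z N - 2 * (s - θ) := by
    rw [Finset.sum_add_distrib, ← Finset.mul_sum, Finset.sum_sub_distrib up lo, hslo, hsup]
    have : ((∑ i, m i : ℤ) : ℝ) + Q * θ - ((∑ i, m i : ℤ) - P * (1 - θ)) = Δ := by rw [hΔ]; ring
    rw [this, hlΔ]
    have : (D : ℝ) = z N - 2 * s - (∑ i, m i : ℤ) := by exact_mod_cast hD
    rw [this]; ring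
  refine ⟨fun i => lo i + l * (up i - lo i), fun i => ?_⟩
  simp only [hsF]
  have hz : (z i : ℝ) = m i + s := by simp [hm]
  have hmi0 : 0 ≤ m i := by simp only [hm]; linarith [h0 i]
  have hmi1 : m i ≤ r i := h1 i
  have hri : (1 : ℝ) ≤ r i := by exact_mod_cast hr i
  rw [hz]
  simp only [hlodef, hupdef]
  by_cases c0 : 0 < m i <;> by_cases c1 : 0 < (r i : ℤ) - m i
  · have e0 : (1 : ℝ) ≤ m i := by exact_mod_cast c0
    have e1 : (m i : ℝ) + 1 ≤ r i := by
      have : m i + 1 ≤ r i := by omega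
      exact_mod_cast this
    simp only [c0, c1, if_true]
    refine ⟨?_, ?_, ?_, ?_⟩ <;> nlinarith
  · have e0 : (1 : ℝ) ≤ m i := by exact_mod_cast c0
    have e1 : (m i : ℝ) = r i := by
      have : m i = r i := by omega
      exact_mod_cast this
    simp only [c0, c1, if_true, if_false]
    refine ⟨?_, ?_, ?_, ?_⟩ <;> nlinarith
  · have e0 : (m i : ℝ) = 0 := by
      have : m i = 0 := by omega
      exact_mod_cast this
    simp only [c0, c1, if_true, if_false, e0]
    refine ⟨?_, ?_, ?_, ?_⟩ <;> nlinarith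
  · exfalso
    have := hr i
    omega

/-- The integers `D` that satisfy the bounds of `exists_isRounding_of_lt_of_lt` for some
`θ ∈ [0, 1)`: `θ = 0` serves `-P < D < 0`, a value of `θ` close to `1` serves `0 ≤ D ≤ Q - 3`, and
`θ = 3 / 4` serves `D = -1` in case `P ≤ 1`. -/
theorem exists_isRounding_of_shift [Fintype ι] [DecidableEq ι] {r : ι → ℕ} (hr : ∀ i, 1 ≤ r i)
    (hcard : 3 ≤ Fintype.card ι) {N : ι} {z : ι → ℤ} (s : ℤ)
    (h0 : ∀ i, s ≤ z i) (h1 : ∀ i, z i - s ≤ r i) {D : ℤ}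
    (hD : D = z N - 2 * s - ∑ i, (z i - s))
    (hlo : -D ≤ 1 ∨ -D < (Finset.univ.filter fun i => 0 < z i - s).card)
    (hup : D + 2 ≤ 1 ∨ D + 2 < (Finset.univ.filter fun i => 0 < (r i : ℤ) - (z i - s)).card) :
    ∃ F, IsRounding r N z F := by
  obtain ⟨P, hP⟩ : ∃ P, (Finset.univ.filter fun i => 0 < z i - s).card = P := ⟨_, rfl⟩
  obtain ⟨Q, hQ⟩ : ∃ Q, (Finset.univ.filter fun i => 0 < (r i : ℤ) - (z i - s)).card = Q :=
    ⟨_, rfl⟩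
  rw [hP] at hlo
  rw [hQ] at hup
  -- `r i ≥ 1`, so each index is counted in `P` or in `Q`
  have hPQ : 3 ≤ P + Q := by
    rw [← hP, ← hQ]
    refine hcard.trans ((Finset.card_le_card (s := Finset.univ) fun i _ => ?_).trans
      (Finset.card_union_le _ _))
    have := hr i
    simp only [Finset.mem_union, Finset.mem_filter, Finset.mem_univ, true_and]
    omega
  rcases lt_or_ge D 0 with hneg | hnn
  · rcases lt_or_ge (-D) P with hDP | hDP
    · refine exists_isRounding_of_lt_of_lt hr s h0 h1 le_rfl zero_lt_one hD hP hQ ?_ ?_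
      · have : -(P : ℝ) < D := by
          have : -(P : ℤ) < D := by omega
          exact_mod_cast this
        simpa using this
      · have : (D : ℝ) < 0 := by exact_mod_cast hneg
        simpa using this
    · have hD1 : (D : ℝ) = -1 := by
        have : D = -1 := by omega
        exact_mod_cast this
      have hQ2 : (2 : ℝ) ≤ Q := by
        have : 2 ≤ Q := by omega
        exact_mod_cast this
      have hP0 : (0 : ℝ) ≤ P := Nat.cast_nonneg P
      refine exists_isRounding_of_lt_of_lt hr s h0 h1 (θ := 3 / 4) (by norm_num) (by norm_num)
        hD hP hQ ?_ ?_
      · rw [hD1]; linarith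
      · rw [hD1]; linarith
  · have hDQ : (D : ℝ) + 3 ≤ Q := by
      have : D + 3 ≤ Q := by omega
      exact_mod_cast this
    have hD0 : (0 : ℝ) ≤ D := by exact_mod_cast hnn
    have hP0 : (0 : ℝ) ≤ P := Nat.cast_nonneg P
    have hQ0 : (0 : ℝ) < 2 * (Q - 2) := by linarith
    have hθ : 1 / (2 * ((Q : ℝ) - 2)) ≤ 1 / 2 := by
      rw [div_le_div_iff₀ hQ0 two_pos]; linarith
    have hθ' : 0 < 1 / (2 * ((Q : ℝ) - 2)) := by positivity
    have hmul : ((Q : ℝ) - 2) * (1 / (2 * (Q - 2))) = 1 / 2 := by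
      have : (Q : ℝ) - 2 ≠ 0 := by linarith
      field_simp
    refine exists_isRounding_of_lt_of_lt hr s h0 h1 (θ := 1 - 1 / (2 * ((Q : ℝ) - 2)))
      (by linarith) (by linarith) hD hP hQ ?_ ?_
    · nlinarith [mul_nonneg hP0 hθ'.le]
    · rw [mul_sub, hmul]; linarith

/-- The inequalities of the region suffice for `z` to be a rounding vector. As the shift `s` runs
from `max (z i - r i)` to `min (z i)`, the number `D` grows in steps of `n - 2`, while the
admissible interval for `D` contains `{0, …, n - 3}` at every `s` above the least one. So either
an interior shift works, or one of the two extreme shifts does, by the upper or the lower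
inequalities of the region. -/
theorem exists_isRounding [Fintype ι] [DecidableEq ι] {r : ι → ℕ} (hr : ∀ i, 1 ≤ r i)
    (hcard : 3 ≤ Fintype.card ι) {N : ι} {z : ι → ℤ}
    (hsub : ∀ i j, z j - z i ≤ r j)
    (hnotMem : ∀ (I : Finset ι) (J : Multiset ι), N ∉ I → N ∉ J → I.card = J.card + 1 →
      (∀ i ∈ I, i ∉ J) →
      -(J.card : ℤ) - ∑ i with i ≠ N ∧ i ∉ I, (r i : ℤ) - (J.map fun j => (r j : ℤ)).sum + 1
          ≤ ∑ i ∈ I, z i - (J.map z).sum ∧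
        ∑ i ∈ I, z i - (J.map z).sum ≤ J.card + 1)
    (hmem : ∀ (I : Finset ι) (J : Multiset ι), N ∉ I → N ∈ J → I.card = J.card + 1 →
      (∀ i ∈ I, i ∉ J) →
      -(J.card : ℤ) - ∑ i with i ≠ N ∧ i ∉ I, (r i : ℤ) - (J.map fun j => (r j : ℤ)).sum + 2
          ≤ ∑ i ∈ I, z i - (J.map z).sum ∧
        ∑ i ∈ I, z i - (J.map z).sum ≤ J.card) :
    ∃ F, IsRounding r N z F := by
  have hN : ∃ j, j ≠ N := Fintype.exists_ne_of_one_lt_card (by omega) N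
  have : Nonempty ι := ⟨N⟩
  have hsums : ∀ (s : ℤ) (I : Finset ι), N ∉ I → z N - 2 * s - ∑ i, (z i - s) =
      -∑ i ∈ I, z i + (I.card - 1) * s - ∑ i with i ≠ N ∧ i ∉ I, (z i - s) := fun s I hI => by
    rw [sum_eq_add_sum_add_sum N I hI, Finset.sum_sub_distrib (s := I), Finset.sum_const,
      nsmul_eq_mul]
    ring
  -- the two bounds for `D` at the extreme shifts, from the upper and the lower inequalities
  have hlow : ∀ s, (∀ i, s ≤ z i) → (∃ i, z i = s) →
      -(z N - 2 * s - ∑ i, (z i - s)) ≤ 1 ∨ -(z N - 2 * s - ∑ i, (z i - s)) <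
        (Finset.univ.filter fun i => 0 < z i - s).card := by
    rintro s hs ⟨i₀, hi₀⟩
    refine le_one_or_lt_card_pos (N := N) (fun i => sub_nonneg.2 (hs i)) (i₀ := i₀)
      (by simp [hi₀]) hN (fun I p j hI hj hc => ?_) (fun I p hI hc => ?_)
    · have h := (hnotMem I (Multiset.replicate p j) hI
        (fun h => by
          rw [Multiset.mem_replicate] at h
          exact (hj h.1).1 h.2.symm)
        (by simpa using hc)
        (fun i hi h => by
          rw [Multiset.mem_replicate] at h
          exact (hj h.1).2 (h.2 ▸ hi))).2
      simp only [Multiset.map_replicate, Multiset.sum_replicate, Multiset.card_replicate,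
        nsmul_eq_mul] at h
      rw [hsums s I hI, hc]
      push_cast
      linarith
    · have h := (hmem I (Multiset.replicate (p + 1) N) hI
        (by simp) (by simpa using hc)
        (fun i hi h => by
          rw [Multiset.mem_replicate] at h
          exact hI (h.2 ▸ hi))).2
      simp only [Multiset.map_replicate, Multiset.sum_replicate, Multiset.card_replicate,
        nsmul_eq_mul] at h
      rw [hsums s I hI, hc]
      push_cast at h ⊢
      linarith
  have hupp : ∀ s, (∀ i, z i - s ≤ r i) → (∃ i, z i - s = r i) →
      (z N - 2 * s - ∑ i, (z i - s)) + 2 ≤ 1 ∨ (z N - 2 * s - ∑ i, (z i - s)) + 2 <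
        (Finset.univ.filter fun i => 0 < (r i : ℤ) - (z i - s)).card := by
    rintro s hs ⟨i₀, hi₀⟩
    refine le_one_or_lt_card_pos (N := N) (fun i => sub_nonneg.2 (hs i)) (i₀ := i₀)
      (by simp [hi₀]) hN (fun I p j hI hj hc => ?_) (fun I p hI hc => ?_)
    · have h := (hnotMem I (Multiset.replicate p j) hI
        (fun h => by
          rw [Multiset.mem_replicate] at h
          exact (hj h.1).1 h.2.symm)
        (by simpa using hc)
        (fun i hi h => by
          rw [Multiset.mem_replicate] at h
          exact (hj h.1).2 (h.2 ▸ hi))).1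
      simp only [Multiset.map_replicate, Multiset.sum_replicate, Multiset.card_replicate,
        nsmul_eq_mul] at h
      rw [hsums s I hI, hc, Finset.sum_sub_distrib (f := fun i => (r i : ℤ))]
      push_cast
      linarith
    · have h := (hmem I (Multiset.replicate (p + 1) N) hI
        (by simp) (by simpa using hc)
        (fun i hi h => by
          rw [Multiset.mem_replicate] at h
          exact hI (h.2 ▸ hi))).1
      simp only [Multiset.map_replicate, Multiset.sum_replicate, Multiset.card_replicate,
        nsmul_eq_mul] at h
      rw [hsums s I hI, hc, Finset.sum_sub_distrib (f := fun i => (r i : ℤ))]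
      push_cast at h ⊢
      linarith
  obtain ⟨i₀, hi₀⟩ := Finite.exists_min z
  obtain ⟨i₁, hi₁⟩ := Finite.exists_max fun i => z i - r i
  have hDs : ∀ s : ℤ, z N - 2 * s - ∑ i, (z i - s) =
      z N - ∑ i, z i + (Fintype.card ι - 2) * s := fun s => by
    rw [Finset.sum_sub_distrib, Finset.sum_const, Finset.card_univ, nsmul_eq_mul]; ring
  set n : ℤ := (Fintype.card ι : ℤ) with hn
  have hn3 : 3 ≤ n := by rw [hn]; exact_mod_cast hcard
  set s₀ : ℤ := z i₀ with hs₀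
  set s₁ : ℤ := z i₁ - r i₁ with hs₁
  rcases le_or_gt (z N - 2 * s₀ - ∑ i, (z i - s₀)) (-1) with hA | hA
  · exact exists_isRounding_of_shift hr hcard s₀ hi₀ (fun i => hsub i₀ i) rfl
      (hlow s₀ hi₀ ⟨i₀, rfl⟩) (Or.inl (by omega))
  rcases le_or_gt (-1) (z N - 2 * s₁ - ∑ i, (z i - s₁)) with hB | hB
  · exact exists_isRounding_of_shift hr hcard s₁ (fun i => by linarith [hsub i i₁])
      (fun i => by linarith [hi₁ i]) rfl (Or.inl (by omega))
      (hupp s₁ (fun i => by linarith [hi₁ i]) ⟨i₁, by simp [hs₁]⟩)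
  rw [hDs] at hA hB
  set D₀ := z N - ∑ i, z i + (n - 2) * s₀ with hD₀
  -- the shift at which `D` is the remainder of `D₀` modulo `n - 2`, hence in `{0, …, n - 3}`
  set s := s₀ - D₀ / (n - 2) with hs
  have hmod : z N - 2 * s - ∑ i, (z i - s) = D₀ % (n - 2) := by
    rw [hDs, Int.emod_def, hs, hD₀]; ring
  have hpos := Int.emod_nonneg D₀ (show n - 2 ≠ 0 by omega)
  have hlt := Int.emod_lt_of_pos D₀ (show 0 < n - 2 by omega)
  have hss₀ : s ≤ s₀ := by
    have : 0 ≤ D₀ / (n - 2) := Int.ediv_nonneg (by omega) (by omega)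
    omega
  have hss₁ : s₁ < s := by
    by_contra hcon
    rw [hDs] at hmod
    have : (n - 2) * s ≤ (n - 2) * s₁ := mul_le_mul_of_nonneg_left (by omega) (by omega)
    omega
  refine exists_isRounding_of_shift hr hcard s (fun i => hss₀.trans (hi₀ i))
    (fun i => by linarith [hi₁ i]) hmod.symm (Or.inl (by omega)) (Or.inr ?_)
  have : (Finset.univ.filter fun i => 0 < (r i : ℤ) - (z i - s)) = Finset.univ :=
    Finset.filter_true_of_mem fun i _ => by linarith [hi₁ i]
  rw [this, Finset.card_univ]
  omega

end Rounding

/-! ### Cones spanned by edges and their support forms -/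

section Graph

variable {V : Type*}

theorem toReal_add (α β : V → ℤ) : toReal (α + β) = toReal α + toReal β := by
  ext v; simp [toReal]

theorem toReal_sub (α β : V → ℤ) : toReal (α - β) = toReal α - toReal β := by
  ext v; simp [toReal]

theorem toReal_sum {ι : Type*} (s : Finset ι) (α : ι → V → ℤ) :
    toReal (∑ j ∈ s, α j) = ∑ j ∈ s, toReal (α j) := by
  ext v; simp [toReal]

theorem toReal_zsmul (m : ℤ) (α : V → ℤ) : toReal (m • α) = (m : ℝ) • toReal α := by
  ext v; simp [toReal]

theorem toReal_edge [DecidableEq V] (a b : V) :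
    toReal (Pi.single a 1 + Pi.single b 1) = Pi.single a 1 + Pi.single b 1 := by
  ext v; simp [toReal, Pi.single_apply]

theorem single_add_single_mem_edgeLattice [DecidableEq V] {G : SimpleGraph V} {a b : V}
    (h : G.Adj a b) :
    Pi.single a 1 + Pi.single b 1 ∈ edgeLattice G :=
  AddSubgroup.subset_closure ⟨a, b, h, rfl⟩

theorem single_add_single_mem_edgeCone [DecidableEq V] {G : SimpleGraph V} {a b : V}
    (h : G.Adj a b) :
    (Pi.single a 1 + Pi.single b 1 : V → ℝ) ∈ edgeCone G :=
  PointedCone.subset_hull ⟨a, b, h, rfl⟩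

theorem nonneg_of_mem_edgeCone [DecidableEq V] {G : SimpleGraph V}
    {ℓ : Module.Dual ℝ (V → ℝ)}
    (hℓ : ∀ a b, G.Adj a b → 0 ≤ ℓ (Pi.single a 1 + Pi.single b 1)) {x : V → ℝ}
    (hx : x ∈ edgeCone G) : 0 ≤ ℓ x := by
  refine Submodule.span_induction (p := fun x _ => 0 ≤ ℓ x) ?_ (by simp) ?_ ?_ hx
  · rintro _ ⟨a, b, h, rfl⟩
    exact hℓ a b h
  · intro x y _ _ hx hy
    rw [map_add]
    exact add_nonneg hx hy
  · rintro ⟨c, hc⟩ x _ hx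
    have : ((⟨c, hc⟩ : {c : ℝ // 0 ≤ c}) • x) = c • x := rfl
    rw [this, map_smul]
    exact mul_nonneg hc hx

theorem eq_top_of_single_mem [Fintype V] [DecidableEq V] {W : Submodule ℝ (V → ℝ)}
    (h : ∀ v, Pi.single v 1 ∈ W) : W = ⊤ := by
  rw [eq_top_iff]
  intro x _
  rw [pi_eq_sum_univ' x]
  refine Submodule.sum_mem _ fun v _ => W.smul_mem _ ?_
  convert h v using 1

theorem finrank_add_one_of_sup_span_singleton [Fintype V] {W : Submodule ℝ (V → ℝ)}
    {ℓ : Module.Dual ℝ (V → ℝ)} (hℓ : ℓ ≠ 0) (hW : W ≤ LinearMap.ker ℓ) {p : V → ℝ}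
    (hp : W ⊔ Submodule.span ℝ {p} = ⊤) :
    Module.finrank ℝ W + 1 = Module.finrank ℝ (V → ℝ) := by
  have h1 := Module.Dual.finrank_ker_add_one_of_ne_zero hℓ
  have h2 := Submodule.finrank_mono hW
  have h3 := Submodule.finrank_add_le_finrank_add_finrank W (Submodule.span ℝ {p})
  have h4 := finrank_span_le_card (R := ℝ) ({p} : Set (V → ℝ))
  rw [hp, finrank_top] at h3
  simp at h4
  omega

theorem apply_eq_mul_of_ker_le {τ ℓ : Module.Dual ℝ (V → ℝ)}
    (h : LinearMap.ker ℓ ≤ LinearMap.ker τ) {p : V → ℝ} (hp : ℓ p = 1) (x : V → ℝ) :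
    τ x = τ p * ℓ x := by
  have : x - ℓ x • p ∈ LinearMap.ker τ := h (by simp [hp])
  rw [LinearMap.mem_ker, map_sub, map_smul, smul_eq_mul, sub_eq_zero] at this
  rw [this, mul_comm]

/-- A support form `ℓ` that dominates a positive multiple of a normalized form `τ ≥ 0` on the cone
is equal to `τ`: the form `τ` vanishes on the facet of `ℓ`, so it is a multiple of `ℓ`, and the
multiple is `1` by the normalization. -/
theorem IsSupportForm.eq_of_mul_le [Fintype V] [DecidableEq V] {G : SimpleGraph V}
    {ℓ τ : Module.Dual ℝ (V → ℝ)}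
    (hℓ : IsSupportForm G ℓ) (htop : Submodule.span ℝ (edgeCone G : Set (V → ℝ)) = ⊤)
    (hτ0 : ∀ x ∈ edgeCone G, 0 ≤ τ x)
    (hτ : ∀ c : ℝ, (∃ α ∈ edgeLattice G, τ (toReal α) = c) ↔ ∃ m : ℤ, c = (m : ℝ))
    {κ : ℝ} (hκ : 0 < κ) (hle : ∀ x ∈ edgeCone G, κ * τ x ≤ ℓ x) : τ = ℓ := by
  obtain ⟨h0, hdim, hval⟩ := hℓ
  obtain ⟨p, hpL, hp⟩ := (hval 1).2 ⟨1, by simp⟩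
  have hne : ℓ ≠ 0 := by rintro rfl; simp at hp
  set W := Submodule.span ℝ {x | x ∈ edgeCone G ∧ ℓ x = 0}
  have hWℓ : W ≤ LinearMap.ker ℓ := Submodule.span_le.2 fun x hx => hx.2
  have hWτ : W ≤ LinearMap.ker τ := Submodule.span_le.2 fun x hx => by
    have h1 := hle x hx.1
    rw [hx.2] at h1
    exact le_antisymm (by nlinarith [hτ0 x hx.1]) (hτ0 x hx.1)
  have hker : W = LinearMap.ker ℓ := by
    refine Submodule.eq_of_le_of_finrank_eq hWℓ ?_
    have := Module.Dual.finrank_ker_add_one_of_ne_zero hne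
    rw [htop, finrank_top] at hdim
    omega
  have hmul := apply_eq_mul_of_ker_le (hker ▸ hWτ) hp
  obtain ⟨m, hm⟩ := (hτ (τ (toReal p))).1 ⟨p, hpL, rfl⟩
  obtain ⟨q, hq, hq1⟩ := (hτ 1).2 ⟨1, by simp⟩
  obtain ⟨m', hm'⟩ := (hval (ℓ (toReal q))).1 ⟨q, hq, rfl⟩
  have hmm : m * m' = 1 := by
    have := hmul (toReal q)
    rw [hq1, hm, hm'] at this
    exact_mod_cast this.symm
  rcases Int.eq_one_or_neg_one_of_mul_eq_one hmm with h1 | h1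
  · refine LinearMap.ext fun x => ?_
    simpa [hm, h1] using hmul x
  · -- a negative factor would make `ℓ` vanish on the cone, which spans the whole space
    exfalso
    apply hne
    have : Submodule.span ℝ (edgeCone G : Set (V → ℝ)) ≤ LinearMap.ker ℓ :=
      Submodule.span_le.2 fun x hx => by
        have h2 := hmul x
        rw [hm, h1] at h2
        have h3 := hτ0 x hx
        have h4 := h0 x hx
        push_cast at h2
        exact le_antisymm (by linarith) h4
    rw [htop, top_le_iff] at this
    exact LinearMap.ker_eq_top.1 this

end Graph

/-! ### The lattice and the facets for complete multipartite graphs -/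

section Multipartite

variable {n : ℕ} {r : Fin n → ℕ}

theorem exists_notMem_of_card_lt (S : Finset (Fin n)) (hS : S.card < n) : ∃ i, i ∉ S := by
  by_contra! h
  have : S = Finset.univ := Finset.eq_univ_of_forall h
  rw [this] at hS
  simp at hS

/-- The only place where the case `n = 3` with a part of size one has to be excluded: the
coordinate of the vertex of that part does not define a facet there. -/
theorem exists_edge_avoiding (hpos : ∀ i, 1 ≤ r i) (hn : (n = 3 ∧ ∀ i, 2 ≤ r i) ∨ 4 ≤ n)
    (i : Fin n) (v : Vert r) :
    ∃ b c : Vert r, b.1 ≠ c.1 ∧ b.1 ≠ i ∧ c.1 ≠ i ∧ b ≠ v ∧ c ≠ v := by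
  rcases hn with ⟨rfl, h2⟩ | h4
  · obtain ⟨p, hp⟩ := exists_notMem_of_card_lt {i} (by simp)
    obtain ⟨q, hq⟩ := exists_notMem_of_card_lt {i, p} (Finset.card_le_two.trans_lt (by norm_num))
    simp only [Finset.mem_singleton, Finset.mem_insert, not_or] at hp hq
    have key : ∀ p, ∃ s : Fin (r p), (⟨p, s⟩ : Vert r) ≠ v := fun p => by
      by_cases h : (⟨p, ⟨0, hpos p⟩⟩ : Vert r) = v
      · exact ⟨⟨1, h2 p⟩, by rw [← h]; simp⟩
      · exact ⟨_, h⟩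
    obtain ⟨s, hs⟩ := key p
    obtain ⟨t, ht⟩ := key q
    exact ⟨⟨p, s⟩, ⟨q, t⟩, fun h => hq.2 h.symm, hp, hq.1, hs, ht⟩
  · obtain ⟨p, hp⟩ := exists_notMem_of_card_lt {i, v.1}
      (Finset.card_le_two.trans_lt (by omega))
    obtain ⟨q, hq⟩ := exists_notMem_of_card_lt {i, v.1, p}
      (Finset.card_le_three.trans_lt (by omega))
    simp only [Finset.mem_singleton, Finset.mem_insert, not_or] at hp hq
    refine ⟨⟨p, ⟨0, hpos p⟩⟩, ⟨q, ⟨0, hpos q⟩⟩, fun h => hq.2.2 h.symm, hp.1, hq.1, ?_, ?_⟩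
    · rintro rfl; exact hp.2 rfl
    · rintro rfl; exact hq.2.1 rfl

theorem exists_part_ne (hn : 3 ≤ n) (hpos : ∀ i, 1 ≤ r i) (i j : Fin n) :
    ∃ b : Vert r, b.1 ≠ i ∧ b.1 ≠ j := by
  obtain ⟨p, hp⟩ := exists_notMem_of_card_lt {i, j} (Finset.card_le_two.trans_lt (by omega))
  simp only [Finset.mem_singleton, Finset.mem_insert, not_or] at hp
  exact ⟨⟨p, ⟨0, hpos p⟩⟩, hp.1, hp.2⟩

theorem exists_triangle (hn : 3 ≤ n) (hpos : ∀ i, 1 ≤ r i) (v : Vert r) :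
    ∃ b c : Vert r, b.1 ≠ c.1 ∧ b.1 ≠ v.1 ∧ c.1 ≠ v.1 := by
  obtain ⟨b, hb, -⟩ := exists_part_ne (r := r) hn hpos v.1 v.1
  obtain ⟨c, hc, hc'⟩ := exists_part_ne (r := r) hn hpos v.1 b.1
  exact ⟨b, c, hc'.symm, hb, hc⟩

theorem adj_iff (a b : Vert r) : (multipartite r).Adj a b ↔ a.1 ≠ b.1 := Iff.rfl

theorem forms_inl (v : Vert r) (x : Vert r → ℝ) : forms r (Sum.inl v) x = x v := rfl

theorem forms_inr (i : Fin n) (x : Vert r → ℝ) :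
    forms r (Sum.inr i) x = (∑ v, x v) / 2 - ∑ s, x ⟨i, s⟩ := by
  have h : ∑ v : Vert r, (if v.1 = i then x v else 0) = ∑ s, x ⟨i, s⟩ := by
    rw [Fintype.sum_sigma, Finset.sum_eq_single i]
    · simp
    · intro j _ hj; simp [hj]
    · simp
  rw [← h]
  simp only [forms, LinearMap.smul_apply, LinearMap.sum_apply, LinearMap.proj_apply, smul_eq_mul]
  rw [Finset.mul_sum, Finset.sum_div, ← Finset.sum_sub_distrib]
  refine Finset.sum_congr rfl fun v _ => ?_
  split_ifs <;> ring

theorem forms_inr_single (i : Fin n) (a : Vert r) :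
    forms r (Sum.inr i) (Pi.single a 1) = if a.1 = i then -(1 / 2) else 1 / 2 := by
  simp only [forms, LinearMap.smul_apply, LinearMap.sum_apply, LinearMap.proj_apply, smul_eq_mul]
  rw [Finset.sum_eq_single a]
  · split_ifs <;> simp
  · intro b _ hb; simp [hb]
  · simp

theorem even_sum_iff_mem_edgeLattice (hn : 3 ≤ n) (hpos : ∀ i, 1 ≤ r i) (α : Vert r → ℤ) :
    α ∈ edgeLattice (multipartite r) ↔ Even (∑ v, α v) := by
  constructor
  · intro h
    refine AddSubgroup.closure_induction (p := fun α _ => Even (∑ v, α v)) ?_ (by simp) ?_ ?_ h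
    · rintro _ ⟨a, b, -, rfl⟩
      simp [Finset.sum_add_distrib]
    · intro x y _ _ hx hy
      simpa [Finset.sum_add_distrib] using hx.add hy
    · intro x _ hx
      simpa using hx
  · intro h
    have hedge : ∀ a b : Vert r, a.1 ≠ b.1 →
        (Pi.single a 1 + Pi.single b 1 : Vert r → ℤ) ∈ edgeLattice (multipartite r) :=
      fun a b hab => single_add_single_mem_edgeLattice hab
    -- `2 e_a = (e_a + e_b) + (e_a + e_c) - (e_b + e_c)` for a triangle `a, b, c`
    have htwo : ∀ a : Vert r,
        (Pi.single a 1 + Pi.single a 1 : Vert r → ℤ) ∈ edgeLattice (multipartite r) := fun a => by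
      obtain ⟨b, c, hbc, hb, hc⟩ := exists_triangle hn hpos a
      have := sub_mem (add_mem (hedge a b hb.symm) (hedge a c hc.symm)) (hedge b c hbc)
      convert this using 1
      abel
    have hsub : ∀ a b : Vert r,
        (Pi.single a 1 - Pi.single b 1 : Vert r → ℤ) ∈ edgeLattice (multipartite r) :=
      fun a b => by
        obtain ⟨c, hca, hcb⟩ := exists_part_ne (r := r) hn hpos a.1 b.1
        have := sub_mem (hedge a c hca.symm) (hedge b c hcb.symm)
        convert this using 1
        abel
    let v₀ : Vert r := ⟨⟨0, by omega⟩, ⟨0, hpos _⟩⟩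
    obtain ⟨m, hm⟩ := h
    have hα : α = ∑ v, α v • (Pi.single v 1 - Pi.single v₀ 1 : Vert r → ℤ) +
        m • (Pi.single v₀ 1 + Pi.single v₀ 1 : Vert r → ℤ) := by
      have h1 : ∑ v, α v • (Pi.single v 1 : Vert r → ℤ) = α := by
        ext w
        simp [Finset.sum_apply, Pi.single_apply]
      simp only [smul_sub, Finset.sum_sub_distrib, h1, ← Finset.sum_smul, hm, smul_add, add_smul]
      abel
    rw [hα]
    exact add_mem (sum_mem fun v _ => zsmul_mem (hsub _ _) _) (zsmul_mem (htwo _) _)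

theorem forms_edge_nonneg (j : Vert r ⊕ Fin n) {a b : Vert r} (hab : a.1 ≠ b.1) :
    0 ≤ forms r j (Pi.single a 1 + Pi.single b 1) := by
  rcases j with v | i
  · rw [forms_inl]
    exact add_nonneg (by rw [Pi.single_apply]; split_ifs <;> simp)
      (by rw [Pi.single_apply]; split_ifs <;> simp)
  · rw [map_add, forms_inr_single, forms_inr_single]
    split_ifs with h1 h2
    · exact absurd (h1.trans h2.symm) hab
    all_goals norm_num

theorem forms_nonneg (j : Vert r ⊕ Fin n) {x : Vert r → ℝ} (hx : x ∈ edgeCone (multipartite r)) :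
    0 ≤ forms r j x :=
  nonneg_of_mem_edgeCone (fun _ _ h => forms_edge_nonneg j h) hx

theorem exists_int_forms (j : Vert r ⊕ Fin n) {α : Vert r → ℤ}
    (hα : α ∈ edgeLattice (multipartite r)) : ∃ m : ℤ, forms r j (toReal α) = m := by
  rcases j with v | i
  · exact ⟨α v, rfl⟩
  · refine AddSubgroup.closure_induction
      (p := fun α _ => ∃ m : ℤ, forms r (Sum.inr i) (toReal α) = m) ?_ ⟨0, ?_⟩ ?_ ?_ hα
    · rintro _ ⟨a, b, -, rfl⟩
      rw [toReal_edge, map_add, forms_inr_single, forms_inr_single]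
      split_ifs
      exacts [⟨-1, by norm_num⟩, ⟨0, by norm_num⟩, ⟨0, by norm_num⟩, ⟨1, by norm_num⟩]
    · have : toReal (0 : Vert r → ℤ) = 0 := by ext; simp [toReal]
      simp [this]
    · rintro x y _ _ ⟨m, hm⟩ ⟨m', hm'⟩
      exact ⟨m + m', by rw [toReal_add, map_add, hm, hm']; push_cast; rfl⟩
    · rintro x _ ⟨m, hm⟩
      exact ⟨-m, by rw [← zero_sub, toReal_sub, map_sub, hm]; simp [forms_inr, toReal]⟩

theorem exists_edge_forms_eq_one (hn : 3 ≤ n) (hpos : ∀ i, 1 ≤ r i) (j : Vert r ⊕ Fin n) :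
    ∃ a b : Vert r, a.1 ≠ b.1 ∧ forms r j (Pi.single a 1 + Pi.single b 1) = 1 := by
  rcases j with v | i
  · obtain ⟨b, hb, -⟩ := exists_part_ne (r := r) hn hpos v.1 v.1
    refine ⟨v, b, hb.symm, ?_⟩
    have : b ≠ v := by rintro rfl; exact hb rfl
    simp [forms_inl, this.symm]
  · obtain ⟨b, c, hbc, hb, hc⟩ := exists_triangle (r := r) hn hpos ⟨i, ⟨0, hpos i⟩⟩
    refine ⟨b, c, hbc, ?_⟩
    rw [map_add, forms_inr_single, forms_inr_single, if_neg hb, if_neg hc]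
    norm_num

theorem exists_forms_eq_iff (hn : 3 ≤ n) (hpos : ∀ i, 1 ≤ r i) (j : Vert r ⊕ Fin n) (c : ℝ) :
    (∃ α ∈ edgeLattice (multipartite r), forms r j (toReal α) = c) ↔ ∃ m : ℤ, c = (m : ℝ) := by
  constructor
  · rintro ⟨α, hα, rfl⟩
    exact exists_int_forms j hα
  · rintro ⟨m, rfl⟩
    obtain ⟨a, b, hab, h⟩ := exists_edge_forms_eq_one hn hpos j
    refine ⟨m • (Pi.single a 1 + Pi.single b 1),
      zsmul_mem (single_add_single_mem_edgeLattice hab) m, ?_⟩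
    rw [toReal_zsmul, map_smul, toReal_edge, h]
    simp

theorem single_mem_of_triangle {W : Submodule ℝ (Vert r → ℝ)} {a b c : Vert r}
    (hab : (Pi.single a 1 + Pi.single b 1 : Vert r → ℝ) ∈ W)
    (hac : (Pi.single a 1 + Pi.single c 1 : Vert r → ℝ) ∈ W)
    (hbc : (Pi.single b 1 + Pi.single c 1 : Vert r → ℝ) ∈ W) : Pi.single a 1 ∈ W := by
  have := W.smul_mem (1 / 2 : ℝ) (sub_mem (add_mem hab hac) hbc)
  convert this using 1
  module

theorem span_edgeCone (hn : 3 ≤ n) (hpos : ∀ i, 1 ≤ r i) :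
    Submodule.span ℝ (edgeCone (multipartite r) : Set (Vert r → ℝ)) = ⊤ := by
  refine eq_top_of_single_mem fun a => ?_
  obtain ⟨b, c, hbc, hb, hc⟩ := exists_triangle hn hpos a
  exact single_mem_of_triangle (b := b) (c := c)
    (Submodule.subset_span (single_add_single_mem_edgeCone (adj_iff _ _ |>.2 hb.symm)))
    (Submodule.subset_span (single_add_single_mem_edgeCone (adj_iff _ _ |>.2 hc.symm)))
    (Submodule.subset_span (single_add_single_mem_edgeCone (adj_iff _ _ |>.2 hbc)))

theorem isSupportForm_forms (hpos : ∀ i, 1 ≤ r i) (hn : (n = 3 ∧ ∀ i, 2 ≤ r i) ∨ 4 ≤ n)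
    (j : Vert r ⊕ Fin n) : IsSupportForm (multipartite r) (forms r j) := by
  have hn3 : 3 ≤ n := by omega
  refine ⟨fun x hx => forms_nonneg j hx, ?_, exists_forms_eq_iff hn3 hpos j⟩
  set W := Submodule.span ℝ {x | x ∈ edgeCone (multipartite r) ∧ forms r j x = 0} with hWdef
  have hW : W ≤ LinearMap.ker (forms r j) := Submodule.span_le.2 fun x hx => hx.2
  have hmem : ∀ a b : Vert r, a.1 ≠ b.1 → forms r j (Pi.single a 1 + Pi.single b 1) = 0 →
      (Pi.single a 1 + Pi.single b 1 : Vert r → ℝ) ∈ W := fun a b hab h =>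
    Submodule.subset_span ⟨single_add_single_mem_edgeCone (adj_iff _ _ |>.2 hab), h⟩
  have hne : forms r j ≠ 0 := by
    intro h
    obtain ⟨a, b, -, h1⟩ := exists_edge_forms_eq_one hn3 hpos j
    rw [h] at h1
    simp at h1
  suffices ∃ p, W ⊔ Submodule.span ℝ {p} = ⊤ by
    obtain ⟨p, hp⟩ := this
    rw [span_edgeCone hn3 hpos, finrank_top]
    exact finrank_add_one_of_sup_span_singleton hne hW hp
  rcases j with v | i
  · refine ⟨Pi.single v 1, eq_top_of_single_mem fun a => ?_⟩
    by_cases hav : a = v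
    · subst hav
      exact le_sup_right (a := W) (Submodule.mem_span_singleton_self _)
    · refine le_sup_left (a := W) ?_
      obtain ⟨b, c, hbc, hb, hc, hbv, hcv⟩ := exists_edge_avoiding hpos hn a.1 v
      refine single_mem_of_triangle (hmem a b hb.symm ?_) (hmem a c hc.symm ?_)
        (hmem b c hbc ?_) <;>
      simp [forms_inl, hav, hbv, hcv]
  · let a₀ : Vert r := ⟨i, ⟨0, hpos i⟩⟩
    refine ⟨Pi.single a₀ 1, ?_⟩
    set U := W ⊔ Submodule.span ℝ {(Pi.single a₀ 1 : Vert r → ℝ)} with hU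
    have hWU : W ≤ U := le_sup_left
    have ha₀ : Pi.single a₀ 1 ∈ U := le_sup_right (a := W) (Submodule.mem_span_singleton_self _)
    have hcross : ∀ a b : Vert r, a.1 = i → b.1 ≠ i →
        (Pi.single a 1 + Pi.single b 1 : Vert r → ℝ) ∈ U := fun a b ha hb => by
      refine hWU (hmem a b (fun h => hb (h.symm.trans ha)) ?_)
      rw [map_add, forms_inr_single, forms_inr_single, if_pos ha, if_neg hb]
      norm_num
    have hout : ∀ b : Vert r, b.1 ≠ i → Pi.single b 1 ∈ U := fun b hb => by
      have := sub_mem (hcross a₀ b rfl hb) ha₀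
      rwa [add_sub_cancel_left] at this
    refine eq_top_of_single_mem fun a => ?_
    by_cases ha : a.1 = i
    · obtain ⟨b, hb, -⟩ := exists_part_ne (r := r) hn3 hpos i i
      have := sub_mem (hcross a b ha hb) (hout b hb)
      rwa [add_sub_cancel_right] at this
    · exact hout a ha

/-- The dual description of the cone: let `c` be the vector of values of `ℓ` at the basis vectors.
If `c` is nonnegative, `ℓ` dominates the multiples of the coordinates. Otherwise all negative
values occur in one part, and with the least value `-μ` in the part `i`, the form `ℓ - 2 μ σ_i`
has nonnegative coefficients. -/
theorem exists_forms_mul_le {ℓ : Module.Dual ℝ (Vert r → ℝ)} (hne : ℓ ≠ 0)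
    (hℓ : ∀ x ∈ edgeCone (multipartite r), 0 ≤ ℓ x) :
    ∃ (j : Vert r ⊕ Fin n) (κ : ℝ), 0 < κ ∧
      ∀ x ∈ edgeCone (multipartite r), κ * forms r j x ≤ ℓ x := by
  set c : Vert r → ℝ := fun v => ℓ (Pi.single v 1) with hc
  have hsum : ∀ x, ℓ x = ∑ v, c v * x v := fun x => by
    rw [LinearMap.pi_apply_eq_sum_univ ℓ x]
    refine Finset.sum_congr rfl fun v _ => ?_
    rw [smul_eq_mul, mul_comm]
    congr 2
    ext w
    simp [Pi.single_apply, eq_comm]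
  have hcadd : ∀ a b : Vert r, a.1 ≠ b.1 → 0 ≤ c a + c b := fun a b hab => by
    rw [hc, ← map_add]
    exact hℓ _ (single_add_single_mem_edgeCone hab)
  by_cases hall : ∀ v, 0 ≤ c v
  · obtain ⟨v, hv⟩ : ∃ v, 0 < c v := by
      by_contra! hcon
      apply hne
      ext1 x
      have : c x = 0 := le_antisymm (hcon x) (hall x)
      ext
      simpa using this
    refine ⟨Sum.inl v, c v, hv, fun x hx => ?_⟩
    rw [hsum, forms_inl]
    exact Finset.single_le_sum (f := fun v => c v * x v)
      (fun w _ => mul_nonneg (hall w) (forms_nonneg (Sum.inl w) hx)) (Finset.mem_univ v)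
  · push Not at hall
    obtain ⟨a', ha'⟩ := hall
    have : Nonempty (Vert r) := ⟨a'⟩
    obtain ⟨a, ha⟩ := Finite.exists_min c
    have haneg : c a < 0 := (ha a').trans_lt ha'
    refine ⟨Sum.inr a.1, 2 * -c a, by linarith, fun x hx => ?_⟩
    rw [hsum]
    simp only [forms, LinearMap.smul_apply, LinearMap.sum_apply, LinearMap.proj_apply, smul_eq_mul]
    rw [← mul_assoc, Finset.mul_sum]
    refine Finset.sum_le_sum fun v _ => ?_
    have hx0 : 0 ≤ x v := forms_nonneg (Sum.inl v) hx
    rw [← mul_assoc]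
    refine mul_le_mul_of_nonneg_right ?_ hx0
    split_ifs with hv
    · linarith [ha v]
    · linarith [hcadd a v (Ne.symm hv)]

/-- The `d + n` given forms are exactly the normalized forms of the facets. -/
theorem isSupportForm_iff (hpos : ∀ i, 1 ≤ r i) (hn : (n = 3 ∧ ∀ i, 2 ≤ r i) ∨ 4 ≤ n)
    (ℓ : Module.Dual ℝ (Vert r → ℝ)) :
    IsSupportForm (multipartite r) ℓ ↔ ∃ j, forms r j = ℓ := by
  have hn3 : 3 ≤ n := by omega
  constructor
  · intro h
    have hne : ℓ ≠ 0 := by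
      rintro rfl
      obtain ⟨p, -, hp⟩ := (h.2.2 1).2 ⟨1, by simp⟩
      simp at hp
    obtain ⟨j, κ, hκ, hle⟩ := exists_forms_mul_le hne h.1
    exact ⟨j, h.eq_of_mul_le (span_edgeCone hn3 hpos) (fun x hx => forms_nonneg j hx)
      (exists_forms_eq_iff hn3 hpos j) hκ hle⟩
  · rintro ⟨j, rfl⟩
    exact isSupportForm_forms hpos hn j

/-- For any two facets, some edge vector lies on the first one but not on the second one. -/
theorem exists_edge_separating (hpos : ∀ i, 1 ≤ r i) (hn : (n = 3 ∧ ∀ i, 2 ≤ r i) ∨ 4 ≤ n)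
    {j j' : Vert r ⊕ Fin n} (hj : j ≠ j') :
    ∃ a b : Vert r, a.1 ≠ b.1 ∧ forms r j (Pi.single a 1 + Pi.single b 1) = 0 ∧
      forms r j' (Pi.single a 1 + Pi.single b 1) = 1 := by
  have hn3 : 3 ≤ n := by omega
  rcases j with v | i <;> rcases j' with w | k
  · have hvw : v ≠ w := fun h => hj (by rw [h])
    obtain ⟨b, hbw, hbv⟩ := exists_part_ne (r := r) hn3 hpos w.1 v.1
    have h1 : b ≠ v := by rintro rfl; exact hbv rfl
    have h2 : b ≠ w := by rintro rfl; exact hbw rfl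
    exact ⟨w, b, hbw.symm, by simp [forms_inl, hvw, h1.symm],
      by simp [forms_inl, h2.symm]⟩
  · obtain ⟨b, c, hbc, hb, hc, hbv, hcv⟩ := exists_edge_avoiding hpos hn k v
    refine ⟨b, c, hbc, by simp [forms_inl, hbv.symm, hcv.symm], ?_⟩
    rw [map_add, forms_inr_single, forms_inr_single, if_neg hb, if_neg hc]
    norm_num
  · obtain ⟨b, hbw, hb⟩ : ∃ b : Vert r, b.1 ≠ w.1 ∧ (w.1 = i ↔ b.1 ≠ i) := by
      by_cases hw : w.1 = i
      · obtain ⟨b, hb, -⟩ := exists_part_ne (r := r) hn3 hpos w.1 w.1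
        exact ⟨b, hb, fun _ => hw ▸ hb, fun _ => hw⟩
      · exact ⟨⟨i, ⟨0, hpos i⟩⟩, fun h => hw h.symm, by simp [hw]⟩
    have h2 : b ≠ w := by rintro rfl; exact hbw rfl
    refine ⟨w, b, hbw.symm, ?_, by simp [forms_inl, h2.symm]⟩
    rw [map_add, forms_inr_single, forms_inr_single]
    by_cases hw : w.1 = i
    · rw [if_pos hw, if_neg (hb.1 hw)]; norm_num
    · rw [if_neg hw, if_pos (by by_contra h; exact hw (hb.2 h))]; norm_num
  · have hik : i ≠ k := fun h => hj (by rw [h])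
    obtain ⟨b, hbi, hbk⟩ := exists_part_ne (r := r) hn3 hpos i k
    refine ⟨⟨i, ⟨0, hpos i⟩⟩, b, hbi.symm, ?_, ?_⟩
    · rw [map_add, forms_inr_single, forms_inr_single, if_pos rfl, if_neg hbi]; norm_num
    · rw [map_add, forms_inr_single, forms_inr_single, if_neg hik, if_neg hbk]; norm_num

/-- The integers `a` can be recovered from the exponent set of `T(a)`: each of the inequalities is
attained. -/
theorem exists_forms_eq_and_le (hpos : ∀ i, 1 ≤ r i) (hn : (n = 3 ∧ ∀ i, 2 ≤ r i) ∨ 4 ≤ n)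
    (a : Vert r ⊕ Fin n → ℤ) (j : Vert r ⊕ Fin n) :
    ∃ α ∈ edgeLattice (multipartite r), (∀ j', (a j' : ℝ) ≤ forms r j' (toReal α)) ∧
      forms r j (toReal α) = a j := by
  have hn3 : 3 ≤ n := by omega
  -- a lattice point in the relative interior of the facet of `j`
  have hβ : ∃ β ∈ edgeLattice (multipartite r), forms r j (toReal β) = 0 ∧
      ∀ j', j' ≠ j → 1 ≤ forms r j' (toReal β) := by
    have : ∀ j' : {j' // j' ≠ j}, ∃ a b : Vert r, a.1 ≠ b.1 ∧
        forms r j (Pi.single a 1 + Pi.single b 1) = 0 ∧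
        forms r j' (Pi.single a 1 + Pi.single b 1) = 1 :=
      fun j' => exists_edge_separating hpos hn j'.2.symm
    choose b c hbc h0 h1 using this
    refine ⟨∑ j' : {j' // j' ≠ j}, (Pi.single (b j') 1 + Pi.single (c j') 1),
      sum_mem fun j' _ => single_add_single_mem_edgeLattice (hbc j'), ?_, fun j' hj' => ?_⟩
    · simp only [toReal_sum, toReal_edge, map_sum, h0, Finset.sum_const_zero]
    · simp only [toReal_sum, toReal_edge, map_sum]
      refine (h1 ⟨j', hj'⟩).symm.le.trans ?_
      exact Finset.single_le_sum
        (f := fun k : {j' // j' ≠ j} => forms r j' (Pi.single (b k) 1 + Pi.single (c k) 1))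
        (fun k _ => forms_edge_nonneg j' (hbc k)) (Finset.mem_univ (⟨j', hj'⟩ : {j' // j' ≠ j}))
  obtain ⟨β, hβL, hβ0, hβ1⟩ := hβ
  obtain ⟨α, hαL, hα⟩ := (exists_forms_eq_iff hn3 hpos j (a j)).2 ⟨_, rfl⟩
  obtain ⟨M, hM⟩ : ∃ M : ℕ, ∀ j', (a j' : ℝ) - forms r j' (toReal α) ≤ M := by
    obtain ⟨B, hB⟩ := (Set.finite_range fun j' => (a j' : ℝ) - forms r j' (toReal α)).bddAbove
    obtain ⟨M, hM⟩ := exists_nat_ge B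
    exact ⟨M, fun j' => (hB ⟨j', rfl⟩).trans hM⟩
  refine ⟨α + (M : ℤ) • β, add_mem hαL (zsmul_mem hβL _), fun j' => ?_, ?_⟩
  · rw [toReal_add, toReal_zsmul, map_add, map_smul, smul_eq_mul]
    by_cases hj : j' = j
    · subst hj; simp [hα, hβ0]
    · have h1 := hβ1 j' hj
      have h2 := hM j'
      have h3 : (0 : ℝ) ≤ M := Nat.cast_nonneg M
      push_cast
      nlinarith
  · rw [toReal_add, toReal_zsmul, map_add, map_smul, hα, hβ0]; simp

end Multipartite

/-! ### Laurent monomials -/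

section Laurent

variable (k : Type*) [Field k] {V : Type*} [Fintype V]

theorem laurentMonomial_add (α β : V → ℤ) :
    laurentMonomial k (α + β) = laurentMonomial k α * laurentMonomial k β := by
  rw [laurentMonomial, laurentMonomial, laurentMonomial, ← Finset.prod_mul_distrib]
  refine Finset.prod_congr rfl fun v _ => zpow_add₀ ?_ _ _
  rw [Ne, FaithfulSMul.algebraMap_eq_zero_iff]
  exact MvPolynomial.X_ne_zero v

theorem laurentMonomial_zero : laurentMonomial k (0 : V → ℤ) = 1 := by
  simp [laurentMonomial]

theorem laurentMonomial_mul_neg (α : V → ℤ) :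
    laurentMonomial k α * laurentMonomial k (-α) = 1 := by
  rw [← laurentMonomial_add, add_neg_cancel, laurentMonomial_zero]

theorem laurentMonomial_ne_zero (α : V → ℤ) : laurentMonomial k α ≠ 0 :=
  left_ne_zero_of_mul_eq_one (laurentMonomial_mul_neg k α)

theorem laurentMonomial_natCast (m : V →₀ ℕ) :
    laurentMonomial k (fun v => (m v : ℤ)) =
      algebraMap (MvPolynomial V k) (FractionRing (MvPolynomial V k))
        (MvPolynomial.monomial m 1) := by
  rw [MvPolynomial.monomial_eq, map_mul, map_one, map_one, one_mul,
    Finsupp.prod_fintype _ _ (fun _ => pow_zero _), map_prod]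
  simp [laurentMonomial]

theorem laurentMonomial_edge [DecidableEq V] (a b : V) :
    laurentMonomial k (Pi.single a 1 + Pi.single b 1) =
      algebraMap (MvPolynomial V k) (FractionRing (MvPolynomial V k))
        (MvPolynomial.X a * MvPolynomial.X b) := by
  have key : ∀ a : V, laurentMonomial k (Pi.single a 1) =
      algebraMap (MvPolynomial V k) (FractionRing (MvPolynomial V k)) (MvPolynomial.X a) :=
    fun a => by
      rw [laurentMonomial, Finset.prod_eq_single a]
      · simp
      · intro b _ hb; simp [hb]
      · simp
  rw [laurentMonomial_add, key, key, map_mul]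

theorem smul_laurentMonomial_natCast (m : V →₀ ℕ) (c : k) :
    c • laurentMonomial k (fun v => (m v : ℤ)) =
      algebraMap (MvPolynomial V k) (FractionRing (MvPolynomial V k))
        (MvPolynomial.monomial m c) := by
  have : MvPolynomial.monomial m c = c • (MvPolynomial.monomial m (1 : k)) := by
    rw [MvPolynomial.smul_monomial, smul_eq_mul, mul_one]
  rw [this, laurentMonomial_natCast]
  exact (map_smul (IsScalarTower.toAlgHom k (MvPolynomial V k) (FractionRing (MvPolynomial V k)))
    c (MvPolynomial.monomial m 1)).symm

theorem linearIndependent_laurentMonomial :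
    LinearIndependent k (laurentMonomial k : (V → ℤ) → FractionRing (MvPolynomial V k)) := by
  classical
  rw [linearIndependent_iff']
  intro s c hc α hα
  -- multiplying by `t^N` with `N` large makes all exponents nonnegative
  let N : V → ℤ := fun v => ∑ β ∈ s, |β v|
  have hN : ∀ β ∈ s, ∀ v, 0 ≤ (β + N) v := fun β hβ v => by
    have := Finset.single_le_sum (f := fun β : V → ℤ => |β v|) (fun _ _ => abs_nonneg _) hβ
    have := neg_abs_le (β v)
    simp only [Pi.add_apply, N]
    linarith
  let e : (V → ℤ) → (V →₀ ℕ) := fun β => Finsupp.equivFunOnFinite.symm fun v => ((β + N) v).toNat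
  have he : ∀ β ∈ s, (fun v => (e β v : ℤ)) = β + N := fun β hβ => by
    ext v
    simp only [e, Finsupp.equivFunOnFinite_symm_apply_apply]
    exact Int.toNat_of_nonneg (hN β hβ v)
  have hsum : ∑ β ∈ s, MvPolynomial.monomial (e β) (c β) = 0 := by
    rw [← FaithfulSMul.algebraMap_eq_zero_iff (MvPolynomial V k)
      (FractionRing (MvPolynomial V k)), map_sum, ← zero_mul (laurentMonomial k N), ← hc,
      Finset.sum_mul]
    refine Finset.sum_congr rfl fun β hβ => ?_
    rw [← smul_laurentMonomial_natCast, he β hβ, laurentMonomial_add, smul_mul_assoc]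
  have hcoeff := congrArg (MvPolynomial.coeff (e α)) hsum
  rw [MvPolynomial.coeff_sum, Finset.sum_eq_single α] at hcoeff
  · simpa using hcoeff
  · intro β hβ hβα
    rw [MvPolynomial.coeff_monomial, if_neg]
    intro h
    apply hβα
    have := he β hβ
    rw [h, he α hα] at this
    exact (add_right_cancel this).symm
  · exact fun h => absurd hα h

theorem laurentMonomial_mem_span_iff {E : Set (V → ℤ)} {α : V → ℤ} :
    laurentMonomial k α ∈ Submodule.span k (laurentMonomial k '' E) ↔ α ∈ E := by
  constructor
  · intro h
    by_contra hα
    exact (linearIndependent_laurentMonomial k).notMem_span_image hα h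
  · exact fun h => Submodule.subset_span ⟨α, h, rfl⟩

theorem mul_laurentMonomial_mem_span {f : FractionRing (MvPolynomial V k)} {E E' : Set (V → ℤ)}
    {β : V → ℤ} (hE : ∀ α ∈ E, α + β ∈ E')
    (hf : f ∈ Submodule.span k (laurentMonomial k '' E)) :
    f * laurentMonomial k β ∈ Submodule.span k (laurentMonomial k '' E') := by
  refine Submodule.span_induction
    (p := fun f _ => f * laurentMonomial k β ∈ Submodule.span k (laurentMonomial k '' E'))
    ?_ (by simp) ?_ ?_ hf
  · rintro _ ⟨α, hα, rfl⟩
    rw [← laurentMonomial_add]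
    exact Submodule.subset_span ⟨_, hE α hα, rfl⟩
  · intro x y _ _ hx hy
    rw [add_mul]
    exact add_mem hx hy
  · intro c x _ hx
    rw [smul_mul_assoc]
    exact Submodule.smul_mem _ _ hx

theorem exists_mul_laurentMonomial_eq {f : FractionRing (MvPolynomial V k)}
    (hf : f ∈ Submodule.span k (Set.range (laurentMonomial k))) :
    ∃ (m : V →₀ ℕ) (P : MvPolynomial V k),
      f * laurentMonomial k (fun v => (m v : ℤ)) = algebraMap _ _ P := by
  refine Submodule.span_induction (p := fun f _ => ∃ (m : V →₀ ℕ) (P : MvPolynomial V k),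
      f * laurentMonomial k (fun v => (m v : ℤ)) = algebraMap _ _ P) ?_ ⟨0, 0, by simp⟩ ?_ ?_ hf
  · rintro _ ⟨α, rfl⟩
    refine ⟨Finsupp.equivFunOnFinite.symm fun v => (α v).natAbs,
      MvPolynomial.monomial
        (Finsupp.equivFunOnFinite.symm fun v => (α v + |α v|).toNat) 1, ?_⟩
    rw [← laurentMonomial_natCast, ← laurentMonomial_add]
    congr 1
    ext v
    simp only [Pi.add_apply, Finsupp.equivFunOnFinite_symm_apply_apply, Int.natCast_natAbs]
    rw [Int.toNat_of_nonneg (by linarith [neg_abs_le (α v)])]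
  · rintro x y _ _ ⟨m, P, h⟩ ⟨m', P', h'⟩
    refine ⟨m + m', P * MvPolynomial.monomial m' 1 + P' * MvPolynomial.monomial m 1, ?_⟩
    have : (fun v => ((m + m') v : ℤ)) = (fun v => (m v : ℤ)) + fun v => (m' v : ℤ) := by
      ext v; simp
    rw [this, laurentMonomial_add, map_add, map_mul, map_mul, ← h, ← h',
      ← laurentMonomial_natCast, ← laurentMonomial_natCast]
    ring
  · rintro c x _ ⟨m, P, h⟩
    refine ⟨m, c • P, ?_⟩
    rw [smul_mul_assoc, h]
    exact (map_smul (IsScalarTower.toAlgHom k (MvPolynomial V k)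
      (FractionRing (MvPolynomial V k))) c P).symm

/-- The units of the ring of Laurent polynomials are the scalar multiples of Laurent monomials. -/
theorem exists_eq_smul_laurentMonomial_of_mul_eq_one {f g : FractionRing (MvPolynomial V k)}
    (hf : f ∈ Submodule.span k (Set.range (laurentMonomial k)))
    (hg : g ∈ Submodule.span k (Set.range (laurentMonomial k))) (hfg : f * g = 1) :
    ∃ (c : k) (γ : V → ℤ), c ≠ 0 ∧ f = c • laurentMonomial k γ := by
  obtain ⟨m, P, hP⟩ := exists_mul_laurentMonomial_eq k hf
  obtain ⟨m', Q, hQ⟩ := exists_mul_laurentMonomial_eq k hg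
  have hPQ : P * Q = MvPolynomial.monomial (m + m') 1 := by
    apply FaithfulSMul.algebraMap_injective (MvPolynomial V k) (FractionRing (MvPolynomial V k))
    have : MvPolynomial.monomial (m + m') (1 : k) =
      MvPolynomial.monomial m 1 * MvPolynomial.monomial m' 1 := by simp
    rw [this, map_mul, map_mul, ← hP, ← hQ, laurentMonomial_natCast, laurentMonomial_natCast,
      mul_mul_mul_comm, hfg, one_mul]
  obtain ⟨q, c, -, hc, rfl⟩ :=
    MvPolynomial.dvd_monomial_one_iff_exists.1 ⟨Q, hPQ.symm⟩
  refine ⟨c, (fun v => (q v : ℤ)) + -fun v => (m v : ℤ), hc.ne_zero, ?_⟩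
  rw [laurentMonomial_add, ← smul_mul_assoc, smul_laurentMonomial_natCast, ← hP, mul_assoc,
    laurentMonomial_mul_neg, mul_one]

end Laurent

/-! ### Isomorphisms between submodules of a field -/

section FractionalIdeals

variable {R K : Type*} [CommRing R] [Field K] [Algebra R K]

/-- A homomorphism between submodules of a field `K` is multiplication by an element of `K`, if the
quotients of the generators are fractions of elements of `R`. -/
theorem exists_linearMap_eq_mul {S : Set K} {x₀ : K} (hx₀ : x₀ ∈ Submodule.span R S)
    (hne : x₀ ≠ 0)
    (hS : ∀ x ∈ S, ∃ p q : R, algebraMap R K q ≠ 0 ∧ q • x = p • x₀) {N : Submodule R K}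
    (φ : Submodule.span R S →ₗ[R] N) : ∃ h : K, ∀ x, (φ x : K) = h * x := by
  refine ⟨φ ⟨x₀, hx₀⟩ * x₀⁻¹, ?_⟩
  rintro ⟨x, hx⟩
  induction hx using Submodule.span_induction with
  | mem x hx =>
    obtain ⟨p, q, hq, h⟩ := hS x hx
    have h1 : q • (⟨x, Submodule.subset_span hx⟩ : Submodule.span R S) = p • ⟨x₀, hx₀⟩ :=
      Subtype.ext h
    have h2 := congrArg (fun y => (φ y : K)) h1
    simp only [map_smul, Submodule.coe_smul, Algebra.smul_def] at h2 h
    apply mul_left_cancel₀ hq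
    rw [h2, mul_left_comm, h]
    field_simp
  | zero =>
    have : (⟨0, zero_mem _⟩ : Submodule.span R S) = 0 := rfl
    rw [this, map_zero]; simp
  | add x y hx hy ihx ihy =>
    have : (⟨x + y, add_mem hx hy⟩ : Submodule.span R S) = ⟨x, hx⟩ + ⟨y, hy⟩ := rfl
    rw [this, map_add, Submodule.coe_add, ihx, ihy, Submodule.coe_add, mul_add]
  | smul s x hx ihx =>
    have : (⟨s • x, Submodule.smul_mem _ s hx⟩ : Submodule.span R S) = s • ⟨x, hx⟩ := rfl
    rw [this, map_smul, Submodule.coe_smul, ihx]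
    simp only [Submodule.coe_smul, mul_smul_comm]

theorem Isomorphic.exists_mul {S T : Set K} {x₀ y₀ : K} (hx₀ : x₀ ∈ S) (hy₀ : y₀ ∈ T)
    (hxne : x₀ ≠ 0) (hyne : y₀ ≠ 0)
    (hS : ∀ x ∈ S, ∃ p q : R, algebraMap R K q ≠ 0 ∧ q • x = p • x₀)
    (hT : ∀ y ∈ T, ∃ p q : R, algebraMap R K q ≠ 0 ∧ q • y = p • y₀)
    (h : Isomorphic (Submodule.span R S) (Submodule.span R T)) :
    ∃ f g : K, f * g = 1 ∧ (∀ x ∈ S, f * x ∈ Submodule.span R T) ∧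
      ∀ y ∈ T, g * y ∈ Submodule.span R S := by
  obtain ⟨φ⟩ := h
  obtain ⟨f, hf⟩ := exists_linearMap_eq_mul (Submodule.subset_span hx₀) hxne hS φ.toLinearMap
  obtain ⟨g, hg⟩ := exists_linearMap_eq_mul (Submodule.subset_span hy₀) hyne hT φ.symm.toLinearMap
  refine ⟨f, g, ?_, fun x hx => ?_, fun y hy => ?_⟩
  · have h1 := hg (φ ⟨x₀, Submodule.subset_span hx₀⟩)
    have h2 := hf ⟨x₀, Submodule.subset_span hx₀⟩
    simp only [LinearEquiv.coe_coe, LinearEquiv.symm_apply_apply] at h1 h2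
    rw [h2, ← mul_assoc] at h1
    rw [mul_comm]
    exact (mul_eq_right₀ hxne).1 h1.symm
  · rw [← hf ⟨x, Submodule.subset_span hx⟩]
    exact Subtype.property _
  · rw [← hg ⟨y, Submodule.subset_span hy⟩]
    exact Subtype.property _

theorem isomorphic_of_mul {S T : Set K} {u v : K} (huv : u * v = 1)
    (hS : ∀ x ∈ S, x * u ∈ T) (hT : ∀ y ∈ T, y * v ∈ S) :
    Isomorphic (Submodule.span R S) (Submodule.span R T) := by
  have hmem : ∀ {S T : Set K} {u : K} (_ : ∀ x ∈ S, x * u ∈ T) (x : K)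
      (_ : x ∈ Submodule.span R S), x * u ∈ Submodule.span R T := fun {S T u} h x hx => by
    refine Submodule.span_induction (p := fun x _ => x * u ∈ Submodule.span R T)
      (fun x hx => Submodule.subset_span (h x hx)) (by simp) ?_ ?_ hx
    · intro x y _ _ hx hy
      rw [add_mul]
      exact add_mem hx hy
    · intro s x _ hx
      rw [smul_mul_assoc]
      exact Submodule.smul_mem _ s hx
  exact ⟨{
    toFun := fun x => ⟨x * u, hmem hS x x.2⟩
    map_add' := fun x y => Subtype.ext (add_mul _ _ _)
    map_smul' := fun s x => Subtype.ext (smul_mul_assoc _ _ _)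
    invFun := fun x => ⟨x * v, hmem hT x x.2⟩
    left_inv := fun x => Subtype.ext (by simp only [mul_assoc, huv, mul_one])
    right_inv := fun x => Subtype.ext (by
      simp only [mul_assoc, (mul_comm v u).trans huv, mul_one]) }⟩

end FractionalIdeals

/-! ### Isomorphic divisorial ideals differ by a lattice translation -/

section Divisorial

variable (k : Type*) [Field k] {V : Type*} [Fintype V] [DecidableEq V] (G : SimpleGraph V)

/-- The exponents of the Laurent monomials that generate `T(a)`. -/
def exponentSet {ι : Type*} (τ : ι → Module.Dual ℝ (V → ℝ)) (a : ι → ℤ) : Set (V → ℤ) :=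
  {α | α ∈ edgeLattice G ∧ ∀ j, (a j : ℝ) ≤ τ j (toReal α)}

variable {ι : Type*} {τ : ι → Module.Dual ℝ (V → ℝ)} {a b : ι → ℤ}

theorem divisorialIdeal_eq_span : divisorialIdeal k G τ a =
    Submodule.span (edgeRing k G) (laurentMonomial k '' exponentSet G τ a) := by
  rw [divisorialIdeal]
  congr 1
  ext f
  constructor
  · rintro ⟨α, h1, h2, rfl⟩
    exact ⟨α, ⟨h1, h2⟩, rfl⟩
  · rintro ⟨α, ⟨h1, h2⟩, rfl⟩
    exact ⟨α, h1, h2, rfl⟩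

variable {G}

/-- `T(a)` is already spanned over `k` by the monomials that generate it over the edge ring. -/
theorem mem_span_of_mem_divisorialIdeal
    (hτ : ∀ j a b, G.Adj a b → 0 ≤ τ j (Pi.single a 1 + Pi.single b 1))
    {f : FractionRing (MvPolynomial V k)} (hf : f ∈ divisorialIdeal k G τ a) :
    f ∈ Submodule.span k (laurentMonomial k '' exponentSet G τ a) := by
  rw [divisorialIdeal_eq_span] at hf
  refine Submodule.span_induction
    (p := fun f _ => f ∈ Submodule.span k (laurentMonomial k '' exponentSet G τ a))
    (fun f hf => Submodule.subset_span hf) (zero_mem _) (fun _ _ _ _ hx hy => add_mem hx hy)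
    ?_ hf
  rintro ⟨s, hs⟩ f hf₀ hf
  clear hf₀
  have hsmul : ((⟨s, hs⟩ : edgeRing k G) • f) =
      algebraMap (MvPolynomial V k) (FractionRing (MvPolynomial V k)) s * f :=
    Algebra.smul_def s f
  rw [hsmul]
  clear hsmul
  induction hs using Algebra.adjoin_induction generalizing f with
  | mem p hp =>
    obtain ⟨v, w, hvw, rfl⟩ := hp
    rw [← laurentMonomial_edge, mul_comm]
    refine mul_laurentMonomial_mem_span k (fun α hα => ⟨add_mem hα.1
      (single_add_single_mem_edgeLattice hvw), fun j => ?_⟩) hf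
    rw [toReal_add, map_add, toReal_edge]
    linarith [hα.2 j, hτ j v w hvw]
  | algebraMap c =>
    rw [← IsScalarTower.algebraMap_apply, ← Algebra.smul_def]
    exact Submodule.smul_mem _ _ hf
  | add x y _ _ hx hy =>
    rw [map_add, add_mul]
    exact add_mem (hx f hf) (hy f hf)
  | mul x y _ _ hx hy =>
    rw [map_mul, mul_assoc]
    exact hx _ (hy f hf)

theorem exists_mul_laurentMonomial_eq_of_mem_edgeLattice {α : V → ℤ} (hα : α ∈ edgeLattice G) :
    ∃ p ∈ edgeRing k G, ∃ q ∈ edgeRing k G, q ≠ 0 ∧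
      algebraMap (MvPolynomial V k) (FractionRing (MvPolynomial V k)) q * laurentMonomial k α =
        algebraMap (MvPolynomial V k) (FractionRing (MvPolynomial V k)) p := by
  refine AddSubgroup.closure_induction (p := fun α _ => ∃ p ∈ edgeRing k G, ∃ q ∈ edgeRing k G,
    q ≠ 0 ∧ algebraMap (MvPolynomial V k) (FractionRing (MvPolynomial V k)) q *
      laurentMonomial k α = algebraMap (MvPolynomial V k) (FractionRing (MvPolynomial V k)) p)
    ?_ ?_ ?_ ?_ hα
  · rintro _ ⟨a, b, hab, rfl⟩
    refine ⟨_, Algebra.subset_adjoin ⟨a, b, hab, rfl⟩, 1, one_mem _, one_ne_zero, ?_⟩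
    rw [laurentMonomial_edge, map_one, one_mul]
  · exact ⟨1, one_mem _, 1, one_mem _, one_ne_zero, by rw [laurentMonomial_zero, mul_one]⟩
  · rintro x y _ _ ⟨p, hp, q, hq, hq0, h⟩ ⟨p', hp', q', hq', hq0', h'⟩
    refine ⟨p * p', mul_mem hp hp', q * q', mul_mem hq hq', mul_ne_zero hq0 hq0', ?_⟩
    rw [laurentMonomial_add, map_mul, map_mul, mul_mul_mul_comm, h, h']
  · rintro x _ ⟨p, hp, q, hq, hq0, h⟩
    refine ⟨q, hq, p, hp, ?_, ?_⟩
    · rintro rfl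
      rw [map_zero, mul_eq_zero, FaithfulSMul.algebraMap_eq_zero_iff] at h
      exact h.elim hq0 (laurentMonomial_ne_zero k x)
    · rw [← h, mul_assoc, laurentMonomial_mul_neg, mul_one]

/-- An isomorphism is multiplication by a unit of the ring of Laurent polynomials, hence, up to a
scalar, by a monomial `t^γ`. -/
theorem Isomorphic.exists_shift
    (hτ : ∀ j a b, G.Adj a b → 0 ≤ τ j (Pi.single a 1 + Pi.single b 1))
    (ha : (exponentSet G τ a).Nonempty) (hb : (exponentSet G τ b).Nonempty)
    (h : Isomorphic (divisorialIdeal k G τ a) (divisorialIdeal k G τ b)) :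
    ∃ γ ∈ edgeLattice G, ∀ α, α ∈ exponentSet G τ a ↔ α + γ ∈ exponentSet G τ b := by
  obtain ⟨α₀, hα₀⟩ := ha
  obtain ⟨β₀, hβ₀⟩ := hb
  have hfrac : ∀ {a : ι → ℤ} {α₀ : V → ℤ} (_ : α₀ ∈ exponentSet G τ a)
      (x : FractionRing (MvPolynomial V k)) (_ : x ∈ laurentMonomial k '' exponentSet G τ a),
      ∃ p q : edgeRing k G,
        algebraMap (edgeRing k G) (FractionRing (MvPolynomial V k)) q ≠ 0 ∧
          q • x = p • laurentMonomial k α₀ := by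
    rintro a α₀ hα₀ _ ⟨α, hα, rfl⟩
    obtain ⟨p, hp, q, hq, hq0, h⟩ :=
      exists_mul_laurentMonomial_eq_of_mem_edgeLattice k (sub_mem hα.1 hα₀.1)
    refine ⟨⟨p, hp⟩, ⟨q, hq⟩, ?_, ?_⟩
    · exact (FaithfulSMul.algebraMap_eq_zero_iff (MvPolynomial V k)
        (FractionRing (MvPolynomial V k))).not.2 hq0
    · have h1 : algebraMap (MvPolynomial V k) (FractionRing (MvPolynomial V k)) q *
          laurentMonomial k α = algebraMap _ _ p * laurentMonomial k α₀ := by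
        rw [← h, mul_assoc, ← laurentMonomial_add, sub_add_cancel]
      exact (Algebra.smul_def _ _).trans (h1.trans (Algebra.smul_def _ _).symm)
  rw [divisorialIdeal_eq_span, divisorialIdeal_eq_span] at h
  obtain ⟨f, g, hfg, hf, hg⟩ := Isomorphic.exists_mul (R := edgeRing k G)
    (K := FractionRing (MvPolynomial V k)) (Set.mem_image_of_mem _ hα₀)
    (Set.mem_image_of_mem _ hβ₀)
    (laurentMonomial_ne_zero k α₀) (laurentMonomial_ne_zero k β₀) (hfrac hα₀) (hfrac hβ₀) h
  have hfα : ∀ α ∈ exponentSet G τ a, f * laurentMonomial k α ∈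
      Submodule.span k (laurentMonomial k '' exponentSet G τ b) := fun α hα => by
    refine mem_span_of_mem_divisorialIdeal k hτ ?_
    rw [divisorialIdeal_eq_span]
    exact hf _ ⟨α, hα, rfl⟩
  have hgβ : ∀ β ∈ exponentSet G τ b, g * laurentMonomial k β ∈
      Submodule.span k (laurentMonomial k '' exponentSet G τ a) := fun β hβ => by
    refine mem_span_of_mem_divisorialIdeal k hτ ?_
    rw [divisorialIdeal_eq_span]
    exact hg _ ⟨β, hβ, rfl⟩
  have hspan : ∀ {f : FractionRing (MvPolynomial V k)} {α : V → ℤ} {E : Set (V → ℤ)},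
      f * laurentMonomial k α ∈ Submodule.span k (laurentMonomial k '' E) →
        f ∈ Submodule.span k (Set.range (laurentMonomial k)) := fun {f α E} h => by
    have := mul_laurentMonomial_mem_span k (β := -α) (E' := Set.univ) (fun _ _ => trivial) h
    rwa [mul_assoc, laurentMonomial_mul_neg, mul_one, Set.image_univ] at this
  obtain ⟨c, γ, hc, hfγ⟩ := exists_eq_smul_laurentMonomial_of_mul_eq_one k
    (hspan (hfα α₀ hα₀)) (hspan (hgβ β₀ hβ₀)) hfg
  have hgγ : g = c⁻¹ • laurentMonomial k (-γ) := by
    have : g * (f * (c⁻¹ • laurentMonomial k (-γ))) = g := by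
      rw [hfγ, smul_mul_smul_comm, laurentMonomial_mul_neg, mul_inv_cancel₀ hc, one_smul, mul_one]
    rw [← this, ← mul_assoc, mul_comm g, hfg, one_mul]
  have hfwd : ∀ α ∈ exponentSet G τ a, α + γ ∈ exponentSet G τ b := fun α hα => by
    have := Submodule.smul_mem _ c⁻¹ (hfα α hα)
    rw [hfγ, smul_mul_assoc, smul_smul, inv_mul_cancel₀ hc, one_smul, ← laurentMonomial_add,
      laurentMonomial_mem_span_iff] at this
    rwa [add_comm]
  refine ⟨γ, ?_, fun α => ⟨hfwd α, fun hα => ?_⟩⟩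
  · have := sub_mem (hfwd α₀ hα₀).1 hα₀.1
    rwa [add_sub_cancel_left] at this
  · have := Submodule.smul_mem _ c (hgβ _ hα)
    rw [hgγ, smul_mul_assoc, smul_smul, mul_inv_cancel₀ hc, one_smul, ← laurentMonomial_add,
      laurentMonomial_mem_span_iff] at this
    simpa [add_comm] using this

theorem isomorphic_of_shift {γ : V → ℤ}
    (h : ∀ α, α ∈ exponentSet G τ a ↔ α + γ ∈ exponentSet G τ b) :
    Isomorphic (divisorialIdeal k G τ a) (divisorialIdeal k G τ b) := by
  rw [divisorialIdeal_eq_span, divisorialIdeal_eq_span]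
  refine isomorphic_of_mul (R := edgeRing k G) (K := FractionRing (MvPolynomial V k))
    (laurentMonomial_mul_neg k γ) ?_ ?_
  · rintro _ ⟨α, hα, rfl⟩
    exact ⟨α + γ, (h α).1 hα, laurentMonomial_add k α γ⟩
  · rintro _ ⟨β, hβ, rfl⟩
    exact ⟨β + -γ, (h _).2 (by simpa using hβ), laurentMonomial_add k β (-γ)⟩

end Divisorial

/-! ### Rounding vectors and the exponents of conic ideals -/

section ConicClasses

variable {n : ℕ} {r : Fin n → ℕ}

theorem mem_conicPoints_of_isRounding (hn : 3 ≤ n) {N : Fin n} (hN : (N : ℕ) + 1 = n)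
    {z : Fin n → ℤ} {F : Fin n → ℝ} (h : IsRounding r N z F) : z ∈ conicPoints r := by
  have hlt : ∀ i : Fin n, (i : ℕ) + 1 < n ↔ i ≠ N := fun i => by rw [Ne, Fin.ext_iff]; omega
  have heq : ∀ i : Fin n, (i : ℕ) + 1 = n ↔ i = N := fun i => by rw [Fin.ext_iff]; omega
  have hzJ : ∀ J : Multiset (Fin n),
      (J.map fun j => (z j : ℝ)).sum = (((J.map z).sum : ℤ) : ℝ) := fun J => by
    simp [Int.cast_multiset_sum, Multiset.map_map]
  have hrJ : ∀ J : Multiset (Fin n), (J.map fun j => (r j : ℝ)).sum =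
      (((J.map fun j => (r j : ℤ)).sum : ℤ) : ℝ) := fun J => by
    simp [Int.cast_multiset_sum, Multiset.map_map]
  simp only [conicPoints, conicRegion, Set.mem_ofPred_eq, hlt, heq, hzJ, hrJ]
  refine ⟨fun i j => ?_, fun I J hI _ hIJ _ => ?_, fun I J hI hJ hIJ _ => ?_⟩
  · exact_mod_cast h.sub_bounds i j
  · exact_mod_cast h.sum_bounds_of_notMem (by simpa using hn) I J (fun h => hI N h rfl) hIJ
  · obtain ⟨j, hj, rfl⟩ := hJ
    exact_mod_cast h.sum_bounds_of_mem I J (fun h => hI _ h rfl) hj hIJ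

theorem exists_isRounding_of_mem_conicPoints (hn : 3 ≤ n) (hpos : ∀ i, 1 ≤ r i) {N : Fin n}
    (hN : (N : ℕ) + 1 = n) {z : Fin n → ℤ} (hz : z ∈ conicPoints r) :
    ∃ F, IsRounding r N z F := by
  have hlt : ∀ i : Fin n, (i : ℕ) + 1 < n ↔ i ≠ N := fun i => by rw [Ne, Fin.ext_iff]; omega
  have heq : ∀ i : Fin n, (i : ℕ) + 1 = n ↔ i = N := fun i => by rw [Fin.ext_iff]; omega
  have hzJ : ∀ J : Multiset (Fin n),
      (J.map fun j => (z j : ℝ)).sum = (((J.map z).sum : ℤ) : ℝ) := fun J => by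
    simp [Int.cast_multiset_sum, Multiset.map_map]
  have hrJ : ∀ J : Multiset (Fin n), (J.map fun j => (r j : ℝ)).sum =
      (((J.map fun j => (r j : ℤ)).sum : ℤ) : ℝ) := fun J => by
    simp [Int.cast_multiset_sum, Multiset.map_map]
  simp only [conicPoints, conicRegion, Set.mem_ofPred_eq, hlt, heq, hzJ, hrJ] at hz
  obtain ⟨h1, h2, h3⟩ := hz
  refine exists_isRounding hpos (by simpa using hn) (fun i j => ?_)
    (fun I J hI hJ hIJ hdis => ?_) (fun I J hI hJ hIJ hdis => ?_)
  · exact_mod_cast (h1 i j).2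
  · exact_mod_cast h2 I J (fun i hi h => hI (h ▸ hi)) (fun i hi h => hJ (h ▸ hi)) hIJ hdis
  · exact_mod_cast h3 I J (fun i hi h => hI (h ▸ hi)) ⟨N, hJ, rfl⟩ hIJ hdis

theorem exponents_inl {w : Vert r} (hw₁ : (w.1 : ℕ) + 1 = n) (hw₂ : (w.2 : ℕ) + 1 = r w.1)
    (z : Fin n → ℤ) (v : Vert r) : exponents r z (Sum.inl v) = if v = w then z w.1 else 0 := by
  have : ((v.1 : ℕ) + 1 = n ∧ (v.2 : ℕ) + 1 = r v.1) ↔ v = w := by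
    constructor
    · obtain ⟨i, s⟩ := v
      obtain ⟨j, t⟩ := w
      rintro ⟨h1, h2⟩
      obtain rfl : i = j := by ext; simp at h1 hw₁; omega
      obtain rfl : s = t := by ext; simp at h2 hw₂; omega
      rfl
    · rintro rfl
      exact ⟨hw₁, hw₂⟩
  simp only [exponents, this]
  split_ifs with h
  · rw [h]
  · rfl

theorem exponents_inr {w : Vert r} (hw₁ : (w.1 : ℕ) + 1 = n) (z : Fin n → ℤ) (i : Fin n) :
    exponents r z (Sum.inr i) = if i = w.1 then 0 else z i := by
  have : (i : ℕ) + 1 = n ↔ i = w.1 := by rw [Fin.ext_iff]; omega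
  simp only [exponents, this]

theorem sum_exponents_inl {w : Vert r} (hw₁ : (w.1 : ℕ) + 1 = n) (hw₂ : (w.2 : ℕ) + 1 = r w.1)
    (z : Fin n → ℤ) (i : Fin n) :
    ∑ s, (exponents r z (Sum.inl ⟨i, s⟩) : ℝ) = if i = w.1 then (z w.1 : ℝ) else 0 := by
  simp only [exponents_inl hw₁ hw₂]
  split_ifs with h
  · subst h
    rw [Finset.sum_eq_single w.2]
    · simp
    · intro s _ hs
      rw [if_neg fun h => hs (eq_of_heq (Sigma.ext_iff.1 h).2)]
      simp
    · simp
  · refine Finset.sum_eq_zero fun s _ => ?_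
    rw [if_neg]
    · simp
    · rintro rfl
      exact h rfl

/-- The value of `σ_i` at `y` in terms of the sums of `y` over the parts, for part sums `-F i`,
with `c` added for the part `N`. -/
theorem forms_inr_of_sum_eq {N : Fin n} {c : ℝ} {F : Fin n → ℝ} {y : Vert r → ℝ}
    (hy : ∀ i, ∑ s, y ⟨i, s⟩ = (if i = N then c else 0) - F i) (i : Fin n) :
    forms r (Sum.inr i) y = (c - ∑ j, F j) / 2 + F i - if i = N then c else 0 := by
  rw [forms_inr, Fintype.sum_sigma]
  simp only [hy, Finset.sum_sub_distrib, Finset.sum_ite_eq', Finset.mem_univ, if_true]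
  ring

/-- The total rounding errors of the parts form the vector `F`. -/
theorem exists_isRounding_of_ceil {w : Vert r} (hpos : ∀ i, 1 ≤ r i) (hw₁ : (w.1 : ℕ) + 1 = n)
    (hw₂ : (w.2 : ℕ) + 1 = r w.1) {z : Fin n → ℤ} {y : Vert r → ℝ}
    (h : ∀ j, ⌈forms r j y⌉ = exponents r z j) : ∃ F, IsRounding r w.1 z F := by
  refine ⟨fun i => ∑ s, (exponents r z (Sum.inl ⟨i, s⟩) - y ⟨i, s⟩), fun i => ?_⟩
  have hsum := forms_inr_of_sum_eq (N := w.1) (c := z w.1) (y := y)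
    (F := fun i => ∑ s, (exponents r z (Sum.inl ⟨i, s⟩) - y ⟨i, s⟩))
    (fun i => by rw [Finset.sum_sub_distrib, sum_exponents_inl hw₁ hw₂]; ring) i
  have hv : ∀ v, y v ≤ exponents r z (Sum.inl v) ∧ (exponents r z (Sum.inl v) : ℝ) < y v + 1 :=
    fun v => by
      rw [← h, forms_inl]
      exact ⟨Int.le_ceil _, Int.ceil_lt_add_one _⟩
  have hi := h (Sum.inr i)
  rw [Int.ceil_eq_iff, hsum, exponents_inr hw₁] at hi
  have : Nonempty (Fin (r i)) := ⟨⟨0, hpos i⟩⟩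
  refine ⟨Finset.sum_nonneg fun s _ => sub_nonneg.2 (hv _).1, ?_, ?_, ?_⟩
  · have := Finset.sum_lt_sum_of_nonempty (s := (Finset.univ : Finset (Fin (r i))))
      Finset.univ_nonempty (f := fun s => (exponents r z (Sum.inl ⟨i, s⟩) : ℝ) - y ⟨i, s⟩)
      (g := fun _ => 1) (fun s _ => by linarith [(hv ⟨i, s⟩).2])
    simpa using this
  · obtain ⟨h1, h2⟩ := hi
    split_ifs at h1 h2 with hiN
    · rw [hiN] at h1 ⊢
      push_cast at h1
      linarith
    · linarith
  · obtain ⟨h1, h2⟩ := hi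
    split_ifs at h1 h2 with hiN
    · rw [hiN] at h2 ⊢
      push_cast at h2
      linarith
    · linarith

/-- Conversely, `F i` is distributed evenly over the vertices of the part `i`. -/
theorem exists_ceil_of_isRounding {w : Vert r} (hpos : ∀ i, 1 ≤ r i) (hw₁ : (w.1 : ℕ) + 1 = n)
    (hw₂ : (w.2 : ℕ) + 1 = r w.1) {z : Fin n → ℤ} {F : Fin n → ℝ} (h : IsRounding r w.1 z F) :
    ∃ y : Vert r → ℝ, ∀ j, ⌈forms r j y⌉ = exponents r z j := by
  have hr : ∀ i, (0 : ℝ) < r i := fun i => by exact_mod_cast hpos i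
  let y : Vert r → ℝ := fun v => exponents r z (Sum.inl v) - F v.1 / r v.1
  refine ⟨y, ?_⟩
  rintro (v | i)
  · rw [forms_inl, Int.ceil_eq_iff]
    have h1 : 0 ≤ F v.1 / r v.1 := div_nonneg (h v.1).1 (hr _).le
    have h2 : F v.1 / r v.1 < 1 := (div_lt_one (hr _)).2 (h v.1).2.1
    simp only [y]
    constructor <;> linarith
  · have hsum := forms_inr_of_sum_eq (N := w.1) (c := z w.1) (y := y) (F := F) (fun i => by
      simp only [y]
      rw [Finset.sum_sub_distrib, sum_exponents_inl hw₁ hw₂, Finset.sum_const, Finset.card_univ,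
        Fintype.card_fin, nsmul_eq_mul, mul_div_cancel₀ _ (hr i).ne']) i
    obtain ⟨-, -, h3, h4⟩ := h i
    rw [Int.ceil_eq_iff, hsum, exponents_inr hw₁]
    split_ifs with hiN
    · rw [hiN] at h3 h4 ⊢
      push_cast
      constructor <;> linarith
    · constructor <;> linarith

/-- Normalization of a class: a translation by a lattice vector makes the ceilings vanish at all
forms except `σ_1, …, σ_{n-1}` and the coordinate of the last vertex. The entries of `γ` other
than the one at `w` are forced to be `⌈x v⌉`, and `c` is the solution of `σ_n(γ) = ⌈σ_n(x)⌉`. -/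
theorem exists_ceil_sub_eq_exponents {w : Vert r} (hn : 3 ≤ n) (hpos : ∀ i, 1 ≤ r i)
    (hw₁ : (w.1 : ℕ) + 1 = n) (hw₂ : (w.2 : ℕ) + 1 = r w.1) (x : Vert r → ℝ) :
    ∃ γ ∈ edgeLattice (multipartite r), ∃ z : Fin n → ℤ,
      ∀ j, ⌈forms r j (x - toReal γ)⌉ = exponents r z j := by
  let γ₀ : Vert r → ℤ := fun v => if v = w then 0 else ⌈x v⌉
  set B : ℤ := ⌈forms r (Sum.inr w.1) x⌉ with hB
  set c : ℤ := ∑ v, γ₀ v - 2 * ∑ s, γ₀ ⟨w.1, s⟩ - 2 * B with hc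
  set γ : Vert r → ℤ := γ₀ + c • Pi.single w 1 with hγ
  have hγB : forms r (Sum.inr w.1) (toReal γ) = B := by
    have h1 : toReal (Pi.single w 1 : Vert r → ℤ) = Pi.single w 1 := by
      ext v; simp [toReal, Pi.single_apply]
    rw [hγ, toReal_add, toReal_zsmul, map_add, map_smul, h1, forms_inr_single, if_pos rfl,
      forms_inr, hc]
    simp only [toReal, smul_eq_mul]
    push_cast
    ring
  refine ⟨γ, ?_, fun i => if i = w.1 then ⌈x w - γ w⌉ else ⌈forms r (Sum.inr i) (x - toReal γ)⌉,
    ?_⟩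
  · rw [even_sum_iff_mem_edgeLattice hn hpos]
    refine ⟨∑ v, γ₀ v - ∑ s, γ₀ ⟨w.1, s⟩ - B, ?_⟩
    have h1 : ∑ v, γ v = ∑ v, γ₀ v + c := by
      simp [hγ, Finset.sum_add_distrib, ← Finset.mul_sum]
    rw [h1, hc]; ring
  · rintro (v | i)
    · rw [exponents_inl hw₁ hw₂, forms_inl]
      split_ifs with hv h
      · rw [hv]; rfl
      · exact absurd rfl h
      · have h1 : γ v = ⌈x v⌉ := by simp [hγ, γ₀, hv]
        simp only [Pi.sub_apply, toReal, h1]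
        rw [Int.ceil_sub_intCast, sub_self]
    · rw [exponents_inr hw₁]
      split_ifs with hi
      · rw [hi, map_sub, hγB, Int.ceil_sub_intCast, ← hB, sub_self]
      · rfl

end ConicClasses

/-! ### Conic divisorial ideals of complete multipartite graphs -/

section Ideals

variable {n : ℕ} {r : Fin n → ℕ} (k : Type*) [Field k]

/-- The family of all support forms may be replaced by the explicit family of `d + n` forms. -/
theorem divisorialIdeal_supportForms (hpos : ∀ i, 1 ≤ r i)
    (hn : (n = 3 ∧ ∀ i, 2 ≤ r i) ∨ 4 ≤ n) (x : Vert r → ℝ) :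
    divisorialIdeal k (multipartite r)
      (fun ℓ : {ℓ : Module.Dual ℝ (Vert r → ℝ) // IsSupportForm (multipartite r) ℓ} => ℓ.1)
      (fun ℓ => ⌈ℓ.1 x⌉) =
    divisorialIdeal k (multipartite r) (forms r) (fun j => ⌈forms r j x⌉) := by
  rw [divisorialIdeal_eq_span, divisorialIdeal_eq_span]
  congr 2
  ext α
  refine and_congr_right fun _ => ⟨fun h j => ?_, ?_⟩
  · exact h ⟨forms r j, (isSupportForm_iff hpos hn _).2 ⟨j, rfl⟩⟩
  · rintro h ⟨ℓ, hℓ⟩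
    obtain ⟨j, rfl⟩ := (isSupportForm_iff hpos hn _).1 hℓ
    exact h j

theorem isomorphic_divisorialIdeal_ceil_sub {γ : Vert r → ℤ}
    (hγ : γ ∈ edgeLattice (multipartite r)) (x : Vert r → ℝ) :
    Isomorphic (divisorialIdeal k (multipartite r) (forms r) fun j => ⌈forms r j x⌉)
      (divisorialIdeal k (multipartite r) (forms r) fun j => ⌈forms r j (x - toReal γ)⌉) := by
  refine isomorphic_of_shift k (γ := -γ) fun α => ?_
  have h1 : toReal (α + -γ) = toReal α - toReal γ := by rw [← sub_eq_add_neg, toReal_sub]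
  refine and_congr ⟨fun h => add_mem h (neg_mem hγ), fun h => ?_⟩ (forall_congr' fun j => ?_)
  · simpa using add_mem h hγ
  · obtain ⟨m, hm⟩ := exists_int_forms j hγ
    beta_reduce
    rw [h1, map_sub, map_sub, hm, Int.ceil_sub_intCast]
    push_cast
    exact (sub_le_sub_iff_right _).symm

theorem forms_shift_eq (hpos : ∀ i, 1 ≤ r i) (hn : (n = 3 ∧ ∀ i, 2 ≤ r i) ∨ 4 ≤ n)
    {a b : Vert r ⊕ Fin n → ℤ} {γ : Vert r → ℤ}
    (h : ∀ α, α ∈ exponentSet (multipartite r) (forms r) a ↔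
      α + γ ∈ exponentSet (multipartite r) (forms r) b) (j : Vert r ⊕ Fin n) :
    forms r j (toReal γ) = b j - a j := by
  obtain ⟨α, hαL, hα, hαj⟩ := exists_forms_eq_and_le hpos hn a j
  obtain ⟨β, hβL, hβ, hβj⟩ := exists_forms_eq_and_le hpos hn b j
  have h1 := ((h α).1 ⟨hαL, hα⟩).2 j
  have h2 := ((h (β - γ)).2 (by rw [sub_add_cancel]; exact ⟨hβL, hβ⟩)).2 j
  rw [toReal_add, map_add] at h1
  rw [toReal_sub, map_sub] at h2
  linarith

/-- The classes of the `T_z` are pairwise different for all `z ∈ ℤⁿ`: if `T_z ≅ T_{z'}`, the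
translation vector `γ` vanishes at all vertices but the last one, and `σ_n(γ) = 0` kills the last
entry. -/
theorem eq_of_isomorphic_idealOf (hpos : ∀ i, 1 ≤ r i)
    (hn : (n = 3 ∧ ∀ i, 2 ≤ r i) ∨ 4 ≤ n) {w : Vert r} (hw₁ : (w.1 : ℕ) + 1 = n)
    (hw₂ : (w.2 : ℕ) + 1 = r w.1) {z z' : Fin n → ℤ}
    (h : Isomorphic (idealOf r k z) (idealOf r k z')) : z = z' := by
  have hne : ∀ a, (exponentSet (multipartite r) (forms r) a).Nonempty := fun a => by
    obtain ⟨α, hα, hα', -⟩ := exists_forms_eq_and_le hpos hn a (Sum.inl w)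
    exact ⟨α, hα, hα'⟩
  obtain ⟨γ, -, hγ⟩ := Isomorphic.exists_shift k
    (fun j a b hab => forms_edge_nonneg j hab) (hne _) (hne _) h
  have hforms := forms_shift_eq hpos hn hγ
  have h0 : ∀ v, v ≠ w → γ v = 0 := fun v hv => by
    have := hforms (Sum.inl v)
    rw [exponents_inl hw₁ hw₂, exponents_inl hw₁ hw₂, if_neg hv, if_neg hv, forms_inl] at this
    simpa [toReal] using this
  have hsingle : toReal γ = (γ w : ℝ) • Pi.single w 1 := by
    ext v
    by_cases hv : v = w
    · subst hv; simp [toReal]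
    · simp [toReal, h0 v hv, hv]
  have hw0 : (γ w : ℝ) = 0 := by
    have := hforms (Sum.inr w.1)
    rw [exponents_inr hw₁, exponents_inr hw₁, if_pos rfl, if_pos rfl, hsingle, map_smul,
      forms_inr_single, if_pos rfl, smul_eq_mul] at this
    push_cast at this
    linarith
  rw [hw0, zero_smul] at hsingle
  have heq : ∀ j, exponents r z j = exponents r z' j := fun j => by
    have := hforms j
    rw [hsingle, map_zero] at this
    have : (exponents r z' j : ℝ) = exponents r z j := by linarith
    exact_mod_cast this.symm
  ext i
  by_cases hi : i = w.1
  · have := heq (Sum.inl w)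
    rw [exponents_inl hw₁ hw₂, exponents_inl hw₁ hw₂, if_pos rfl, if_pos rfl] at this
    rw [hi, this]
  · have := heq (Sum.inr i)
    rwa [exponents_inr hw₁, exponents_inr hw₁, if_neg hi, if_neg hi] at this

end Ideals

end ConicEdge

theorem theorem1p5 (k : Type*) [Field k] (n : ℕ) (r : Fin n → ℕ)
    (hpos : ∀ i, 1 ≤ r i) (hmono : Monotone r)
    (hn : (n = 3 ∧ ∀ i, 2 ≤ r i) ∨ 4 ≤ n) :
    -- every conic divisorial ideal is isomorphic to the one of some lattice point of the polytope
    (∀ M, ConicEdge.IsConicDivisorialIdeal k (ConicEdge.multipartite r) M →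
      ∃ z ∈ ConicEdge.conicPoints r, ConicEdge.Isomorphic M (ConicEdge.idealOf r k z)) ∧
    -- different lattice points give non-isomorphic ideals
    (∀ z ∈ ConicEdge.conicPoints r, ∀ z' ∈ ConicEdge.conicPoints r,
      ConicEdge.Isomorphic (ConicEdge.idealOf r k z) (ConicEdge.idealOf r k z') → z = z') ∧
    -- if `n ≤ 4`, every lattice point of the polytope gives a conic divisorial ideal
    (n ≤ 4 → ∀ z ∈ ConicEdge.conicPoints r,
      ConicEdge.IsConicDivisorialIdeal k (ConicEdge.multipartite r)
        (ConicEdge.idealOf r k z)) := by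
  have hn3 : 3 ≤ n := by omega
  obtain ⟨w, hw₁, hw₂⟩ : ∃ w : ConicEdge.Vert r, (w.1 : ℕ) + 1 = n ∧ (w.2 : ℕ) + 1 = r w.1 := by
    have hN : n - 1 < n := by omega
    have hs := hpos ⟨n - 1, hN⟩
    exact ⟨⟨⟨n - 1, hN⟩, ⟨r ⟨n - 1, hN⟩ - 1, by omega⟩⟩, by simp only; omega, by simp only; omega⟩
  refine ⟨?_, fun z _ z' _ h =>
    ConicEdge.eq_of_isomorphic_idealOf k hpos hn hw₁ hw₂ h, fun _ z hz => ?_⟩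
  · rintro _ ⟨x, rfl⟩
    obtain ⟨γ, hγ, z, hz⟩ := ConicEdge.exists_ceil_sub_eq_exponents hn3 hpos hw₁ hw₂ x
    obtain ⟨F, hF⟩ := ConicEdge.exists_isRounding_of_ceil hpos hw₁ hw₂ hz
    refine ⟨z, ConicEdge.mem_conicPoints_of_isRounding hn3 hw₁ hF, ?_⟩
    have := ConicEdge.isomorphic_divisorialIdeal_ceil_sub k hγ x
    rw [ConicEdge.divisorialIdeal_supportForms k hpos hn]
    rwa [funext hz] at this
  · obtain ⟨F, hF⟩ := ConicEdge.exists_isRounding_of_mem_conicPoints hn3 hpos hw₁ hz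
    obtain ⟨y, hy⟩ := ConicEdge.exists_ceil_of_isRounding hpos hw₁ hw₂ hF
    exact ⟨y, by rw [ConicEdge.divisorialIdeal_supportForms k hpos hn, funext hy]; rfl⟩
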